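/- Let $m\ge 2$ and $d\ge 1$ be integers, and let $\Sigma=\{1,\dots,m\}^{\mathbb N}$ carry the metric $d(x,y)=m^{-n}$ for $x\ne y$, where $n\ge 1$ is the smallest index with $x_n\neq y_n$. Let $A$ be a primitive $m\times m$ matrix with entries in $\{0,1\}$, let $\Sigma_A=\{x\in\Sigma: A_{x_kx_{k+1}}=1 \text{ for all } k\ge 1\}$ with the shift map $\sigma$, let $\Sigma_{A,n}$ be the set of words $j_1\cdots j_n$ over $\{1,\dots,m\}$ with $A_{j_kj_{k+1}}=1$ for $1\le k<n$, and for $J=j_1\cdots j_n\in\Sigma_{A,n}$ let $[J]=\{x\in\Sigma_A: x_k=j_k,\ 1\le k\le n\}$. For a non-negative $d\times d$ matrix $B$ put $\|B\|=\mathbf 1^{t}B\mathbf 1$, the sum of its entries. Let $M$ be a function on $\Sigma_A$ with values in the non-negative $d\times d$ matrices such that (H1) there are matrices $M_1,\dots,M_m$ with $M(x)=M_i$ for all $x\in\Sigma_A$ with $x_1=i$; (H2) there is an integer $r>0$ such that for all $i,j\in\{1,\dots,m\}$ all entries of the matrix $\sum_{k=1}^{r}\sum_{K}M_K$ are positive,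 where the inner sum is over the words $K\in\Sigma_{A,k}$ with $iKj\in\Sigma_{A,k+2}$, and $M_K=M_{k_1}\cdots M_{k_n}$ for a word $K=k_1\cdots k_n$. Then for every $q>0$ the limit $$P(q)=\lim_{n\to\infty}\frac1n\log\sum_{J\in\Sigma_{A,n}}\sup_{x\in[J]}\|M(x)M(\sigma x)\cdots M(\sigma^{n-1}x)\|^q$$ exists in $\mathbb R$ (under (H1) the supremum equals $\|M_J\|^q$), the function $P$ is differentiable at $q$, and for $\alpha=P'(q)$ the set $$E(\alpha)=\Big\{J=(j_i)\in\Sigma_A:\ \lim_{n\to\infty}\frac1n\log\|M_{j_1}\cdots M_{j_n}\|=\alpha\Big\}$$ (with $\log 0=-\infty$) has Hausdorff dimension $$\dim_H E(\alpha)=\frac{1}{\log m}\big(-\alpha q+P(q)\big).$$ -/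

import Mathlib

open Filter Topology

noncomputable section

namespace MatrixPressure

/-- The full shift space on the `m` symbols of `Fin m`. Sequences are indexed from `0`, so the
coordinate `x_k` (with `k ≥ 1`) of the usual notation is `x (k - 1)`. -/
def FullShift (m : ℕ) : Type := ℕ → Fin m

/-- The first index, counted from `0`, at which `x` and `y` differ (`0` if `x = y`). -/
def firstDiff {m : ℕ} (x y : FullShift m) : ℕ := PiNat.firstDiff (E := fun _ => Fin m) x y

theorem firstDiff_comm {m : ℕ} (x y : FullShift m) : firstDiff x y = firstDiff y x :=
  PiNat.firstDiff_comm (E := fun _ => Fin m) x y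

theorem min_firstDiff_le {m : ℕ} (x y z : FullShift m) (h : x ≠ z) :
    min (firstDiff x y) (firstDiff y z) ≤ firstDiff x z :=
  PiNat.min_firstDiff_le (E := fun _ => Fin m) x y z h

/-- The distance `m ^ (-n)`, where `n ≥ 1` is the position (counted from `1`) of the first
symbol at which `x` and `y` differ; `firstDiff` counts positions from `0`. -/
def shiftDist {m : ℕ} (x y : FullShift m) : ℝ :=
  open Classical in
  if x = y then 0
  else ((m : ℝ) ^ (firstDiff x y + 1))⁻¹

theorem one_le_of_point {m : ℕ} (x : FullShift m) : (1 : ℝ) ≤ m := by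
  exact_mod_cast Fin.pos (x 0)

theorem shiftDist_nonneg {m : ℕ} (x y : FullShift m) : 0 ≤ shiftDist x y := by
  unfold shiftDist
  split_ifs <;> positivity

theorem shiftDist_comm {m : ℕ} (x y : FullShift m) : shiftDist x y = shiftDist y x := by
  by_cases h : x = y
  · rw [h]
  · simp only [shiftDist, h, Ne.symm h, if_false, firstDiff_comm x y]

theorem shiftDist_triangle {m : ℕ} (x y z : FullShift m) :
    shiftDist x z ≤ shiftDist x y + shiftDist y z := by
  by_cases hxz : x = z
  · have h := add_nonneg (shiftDist_nonneg x y) (shiftDist_nonneg y z)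
    simpa [shiftDist, hxz] using h
  by_cases hxy : x = y
  · subst hxy
    simp [shiftDist]
  by_cases hyz : y = z
  · subst hyz
    simp [shiftDist]
  have h1 := one_le_of_point x
  have key : ∀ a b : ℕ, a ≤ b → ((m : ℝ) ^ (b + 1))⁻¹ ≤ ((m : ℝ) ^ (a + 1))⁻¹ := by
    intro a b hab
    apply inv_anti₀ (by positivity)
    exact pow_le_pow_right₀ h1 (by omega)
  have hmin := min_firstDiff_le x y z hxz
  have e1 := shiftDist_nonneg x y
  have e2 := shiftDist_nonneg y z
  simp only [shiftDist, hxz, hxy, hyz, if_false] at e1 e2 ⊢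
  rcases min_le_iff.1 hmin with h | h
  · linarith [key _ _ h]
  · linarith [key _ _ h]

theorem eq_of_shiftDist_eq_zero {m : ℕ} {x y : FullShift m} (h : shiftDist x y = 0) :
    x = y := by
  by_contra hxy
  have h1 := one_le_of_point x
  have h2 : (0 : ℝ) < ((m : ℝ) ^ (firstDiff x y + 1))⁻¹ := by
    positivity
  simp only [shiftDist, hxy, if_false] at h
  linarith

instance instMetricSpaceFullShift (m : ℕ) : MetricSpace (FullShift m) where
  dist := shiftDist
  dist_self x := by simp [shiftDist]
  dist_comm := shiftDist_comm
  dist_triangle := shiftDist_triangle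
  eq_of_dist_eq_zero := eq_of_shiftDist_eq_zero

/-- The subshift of finite type `Σ_A`, with the metric induced from the full shift. -/
abbrev Subshift {m : ℕ} (A : Matrix (Fin m) (Fin m) ℤ) : Type :=
  {x : FullShift m // ∀ k : ℕ, A (x k) (x (k + 1)) = 1}

/-- The shift map `σ` on `Σ_A`. -/
def shift {m : ℕ} (A : Matrix (Fin m) (Fin m) ℤ) (x : Subshift A) : Subshift A :=
  ⟨fun k => x.1 (k + 1), fun k => x.2 (k + 1)⟩

/-- The word `J = j_1 ⋯ j_n` is admissible: `A j_k j_{k+1} = 1` for `1 ≤ k < n`. -/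
def Admissible {m : ℕ} (A : Matrix (Fin m) (Fin m) ℤ) {n : ℕ} (J : Fin n → Fin m) : Prop :=
  ∀ (k : ℕ) (hk : k + 1 < n), A (J ⟨k, by omega⟩) (J ⟨k + 1, hk⟩) = 1

/-- `Σ_{A,n}`: the admissible words of length `n`. -/
def words {m : ℕ} (A : Matrix (Fin m) (Fin m) ℤ) (n : ℕ) : Finset (Fin n → Fin m) :=
  open Classical in Finset.univ.filter (Admissible A)

/-- `Σ_{A,k;i,j}`: the admissible words `K` of length `k` such that the word `iKj` of length
`k + 2` is admissible. -/
def connectingWords {m : ℕ} (A : Matrix (Fin m) (Fin m) ℤ) (k : ℕ) (i j : Fin m) :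
    Finset (Fin k → Fin m) :=
  open Classical in
  (words A k).filter fun K =>
    Admissible A (Fin.cons (α := fun _ => Fin m) i (Fin.snoc (α := fun _ => Fin m) K j))

/-- The cylinder `[J]` in `Σ_A`. -/
def cylinder {m : ℕ} (A : Matrix (Fin m) (Fin m) ℤ) {n : ℕ} (J : Fin n → Fin m) :
    Set (Subshift A) :=
  {x | ∀ k : Fin n, x.1 k = J k}

/-- `‖B‖ = 1ᵗ B 1`, the sum of all entries of `B`. -/
def entrySum {d : ℕ} (B : Matrix (Fin d) (Fin d) ℝ) : ℝ := ∑ s, ∑ t, B s t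

/-- The product `M(x) M(σ x) ⋯ M(σ^{n-1} x)`. -/
def orbitProd {m d : ℕ} {A : Matrix (Fin m) (Fin m) ℤ}
    (M : Subshift A → Matrix (Fin d) (Fin d) ℝ) (n : ℕ) (x : Subshift A) :
    Matrix (Fin d) (Fin d) ℝ :=
  (List.ofFn fun k : Fin n => M ((shift A)^[k] x)).prod

/-- The product `M_J = M_{j_1} ⋯ M_{j_n}` along a word `J = j_1 ⋯ j_n`. -/
def wordProd {m d : ℕ} (Mi : Fin m → Matrix (Fin d) (Fin d) ℝ) {n : ℕ} (J : Fin n → Fin m) :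
    Matrix (Fin d) (Fin d) ℝ :=
  (List.ofFn fun k : Fin n => Mi (J k)).prod

/-- `(1 / n) log ∑_{J ∈ Σ_{A,n}} sup_{x ∈ [J]} ‖M(x) M(σ x) ⋯ M(σ^{n-1} x)‖ ^ q`. -/
def pressureSeq {m d : ℕ} {A : Matrix (Fin m) (Fin m) ℤ}
    (M : Subshift A → Matrix (Fin d) (Fin d) ℝ) (q : ℝ) (n : ℕ) : ℝ :=
  1 / (n : ℝ) *
    Real.log (∑ J ∈ words A n, ⨆ x : cylinder A J, entrySum (orbitProd M n x.1) ^ q)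

/-- The pressure function `P(q)` of `M`. -/
def pressure {m d : ℕ} {A : Matrix (Fin m) (Fin m) ℤ}
    (M : Subshift A → Matrix (Fin d) (Fin d) ℝ) (q : ℝ) : ℝ :=
  limUnder atTop (pressureSeq M q)

/-- Condition (H1): `M` depends only on the first symbol, with value `M_i` on `[i]`. -/
def IsLocallyConst {m d : ℕ} {A : Matrix (Fin m) (Fin m) ℤ}
    (M : Subshift A → Matrix (Fin d) (Fin d) ℝ) (Mi : Fin m → Matrix (Fin d) (Fin d) ℝ) : Prop :=
  ∀ x : Subshift A, M x = Mi (x.1 0)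

/-- Condition (H2): there is `r > 0` such that for all symbols `i, j` the matrix
`∑_{k=1}^r ∑_{K ∈ Σ_{A,k;i,j}} M_K` has only positive entries. -/
def IsIrreducibleFamily {m d : ℕ} (A : Matrix (Fin m) (Fin m) ℤ)
    (Mi : Fin m → Matrix (Fin d) (Fin d) ℝ) : Prop :=
  ∃ r : ℕ, 0 < r ∧ ∀ (i j : Fin m) (s t : Fin d),
    0 < (∑ k ∈ Finset.Icc 1 r, ∑ K ∈ connectingWords A k i j, wordProd Mi K) s t

/-- The level set `E(α)` of the sequences `J = (j_i) ∈ Σ_A` such that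
`lim (1 / n) log ‖M_{j_1} ⋯ M_{j_n}‖ = α`. Since `log 0 = -∞`, a sequence with a vanishing
product (all later products vanish as well) does not belong to `E(α)`; as `Real.log 0 = 0`,
this is stated explicitly. -/
def levelSet {m d : ℕ} (A : Matrix (Fin m) (Fin m) ℤ)
    (Mi : Fin m → Matrix (Fin d) (Fin d) ℝ) (α : ℝ) : Set (Subshift A) :=
  {J | (∀ n : ℕ, 0 < entrySum (wordProd Mi fun k : Fin n => J.1 k)) ∧
    Tendsto (fun n : ℕ => Real.log (entrySum (wordProd Mi fun k : Fin n => J.1 k)) / (n : ℝ))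
      atTop (𝓝 α)}

end MatrixPressure

end

noncomputable section

namespace MatrixPressure

open MeasureTheory

/-! Extend `J ↦ ‖M_J‖` by zero to inadmissible words. The resulting weight `w` is submultiplicative,
and (H2) makes it supermultiplicative up to a constant once a connecting word of bounded length is
inserted. With a positive letter and a linear bound on `|log w|` where `w > 0`, these are the axioms
of `Weight`; they pass to `w ^ q` for `q > 0`, and the analysis uses nothing else about the
matrices.

The sum of `w ^ q` over words of length `n` is then comparable to `exp (n P(q))`
(`Weight.exists_wordSum_bounds`). A weak limit of averaged point masses gives a shift-invariant
probability measure `μ` with `μ[J]` comparable to `exp (-n P(q)) w(J) ^ q`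
(`Weight.exists_isGibbs`), and the connecting words make it ergodic (`IsGibbs.ergodic`).

`P` is convex by Hölder. For differentiability, `(1/N) log w(x_1 ⋯ x_N)` is close in `L¹(μ)` to a
constant `lam` for arbitrarily large `N` (`IsGibbs.exists_exponent`). The Gibbs bounds give `∫ w ^
(K/N) ∂μ ≥ c exp (N (P(q + K/N) - P(q)))` with `c` independent of `K` and `N`. If `s` is the slope
of a line supporting `P` at `q`, the right side is at least `c exp (K s)`, while the left side
approaches `exp (K lam)`. Letting `K → ±∞` shows that the right derivative is at most `lam` and the
left one at least `lam` (`IsGibbs.exists_slope`), so they agree.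

With `α = P'(q)`, exponential moments and Borel–Cantelli show that `μ`-almost every sequence grows
at rate `α`. The upper bound for the dimension counts the cylinders with `w ≥ exp (n β)`, `β < α`,
by means of the sum of `w ^ q`; the lower bound is the mass distribution principle for `μ`, since
`μ[x_1 ⋯ x_n] = exp (n (α q - P(q)) + o(n))` on the level set and a cylinder of length `n` has
diameter about `m ^ (-n)`. -/

/-- The sum of `f` over all words of length `n`. -/
def wordSum {m : ℕ} (n : ℕ) (f : List (Fin m) → ℝ) : ℝ := ∑ J : Fin n → Fin m, f (List.ofFn J)

/-! ### Sums over all words of a fixed length -/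

section WordSum

variable {m : ℕ} {f g : List (Fin m) → ℝ}

theorem wordSum_zero (f : List (Fin m) → ℝ) : wordSum 0 f = f [] := by
  simp [wordSum]

theorem wordSum_succ (n : ℕ) (f : List (Fin m) → ℝ) :
    wordSum (n + 1) f = ∑ a, wordSum n fun l => f (a :: l) := by
  unfold wordSum
  rw [← (Fin.consEquiv fun _ : Fin (n + 1) => Fin m).sum_comp, Fintype.sum_prod_type]
  simp [Fin.consEquiv, List.ofFn_succ]

theorem wordSum_add (n k : ℕ) (f : List (Fin m) → ℝ) :
    wordSum (n + k) f = wordSum n fun I => wordSum k fun J => f (I ++ J) := by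
  induction n generalizing f with
  | zero => simp [wordSum_zero]
  | succ n ih =>
    rw [Nat.succ_add, wordSum_succ, wordSum_succ]
    simp [ih]

theorem wordSum_le_wordSum {n : ℕ} (h : ∀ l, l.length = n → f l ≤ g l) :
    wordSum n f ≤ wordSum n g :=
  Finset.sum_le_sum fun J _ => h _ (by simp)

theorem wordSum_congr {n : ℕ} (h : ∀ l, l.length = n → f l = g l) :
    wordSum n f = wordSum n g :=
  Finset.sum_congr rfl fun J _ => h _ (by simp)

theorem wordSum_nonneg {n : ℕ} (h : ∀ l, 0 ≤ f l) : 0 ≤ wordSum n f :=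
  Finset.sum_nonneg fun _ _ => h _

theorem wordSum_mul_left (n : ℕ) (c : ℝ) (f : List (Fin m) → ℝ) :
    wordSum n (fun l => c * f l) = c * wordSum n f := by
  simp [wordSum, Finset.mul_sum]

theorem wordSum_mul_right (n : ℕ) (c : ℝ) (f : List (Fin m) → ℝ) :
    wordSum n (fun l => f l * c) = wordSum n f * c := by
  simp [wordSum, Finset.sum_mul]

theorem wordSum_sum {ι : Type*} (s : Finset ι) (n : ℕ) (f : ι → List (Fin m) → ℝ) :
    wordSum n (fun l => ∑ i ∈ s, f i l) = ∑ i ∈ s, wordSum n (f i) := by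
  simp only [wordSum]
  rw [Finset.sum_comm]

theorem wordSum_comm (n k : ℕ) (f : List (Fin m) → List (Fin m) → ℝ) :
    wordSum n (fun I => wordSum k fun J => f I J) =
      wordSum k fun J => wordSum n fun I => f I J := by
  simp only [wordSum]
  rw [Finset.sum_comm]

theorem le_wordSum (h : ∀ l, 0 ≤ f l) (l : List (Fin m)) : f l ≤ wordSum l.length f := by
  have := Finset.single_le_sum (f := fun J : Fin l.length → Fin m => f (List.ofFn J))
    (fun _ _ => h _) (Finset.mem_univ l.get)
  simpa [wordSum] using this

theorem wordSum_ite_eq (l₀ : List (Fin m)) (c : ℝ) :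
    wordSum l₀.length (fun l => if l = l₀ then c else 0) = c := by
  unfold wordSum
  rw [Finset.sum_eq_single l₀.get]
  · simp
  · intro J _ hJ
    refine if_neg fun h => ?_
    apply hJ
    apply List.ofFn_injective
    simpa using h
  · simp

end WordSum

/-! ### Weights on words and their pressure -/

/-- Submultiplicative weights on words that can be supermultiplicatively connected
by words of bounded length. -/
structure Weight {m : ℕ} (u : List (Fin m) → ℝ) : Prop where
  nonneg : ∀ l, 0 ≤ u l
  append_le : ∀ I J, u (I ++ J) ≤ u I * u J
  exists_letter : ∃ a, 0 < u [a]
  connect : ∃ C : ℝ, 0 < C ∧ ∃ r : ℕ, ∀ I J, ∃ K : List (Fin m),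
    K.length ≤ r ∧ u I * u J ≤ C * u (I ++ K ++ J)
  log_bound : ∃ D : ℝ, 0 ≤ D ∧ ∀ l, 0 < u l → |Real.log (u l)| ≤ D * (l.length + 1)

namespace Weight

variable {m : ℕ} {u : List (Fin m) → ℝ}

theorem rpow (hu : Weight u) {q : ℝ} (hq : 0 < q) : Weight fun l => u l ^ q where
  nonneg l := Real.rpow_nonneg (hu.nonneg l) q
  append_le I J := by
    rw [← Real.mul_rpow (hu.nonneg _) (hu.nonneg _)]
    exact Real.rpow_le_rpow (hu.nonneg _) (hu.append_le I J) hq.le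
  exists_letter := by
    obtain ⟨a, ha⟩ := hu.exists_letter
    exact ⟨a, Real.rpow_pos_of_pos ha q⟩
  connect := by
    obtain ⟨C, hC, r, h⟩ := hu.connect
    refine ⟨C ^ q, Real.rpow_pos_of_pos hC q, r, fun I J => ?_⟩
    obtain ⟨K, hK, h⟩ := h I J
    refine ⟨K, hK, ?_⟩
    rw [← Real.mul_rpow (hu.nonneg _) (hu.nonneg _), ← Real.mul_rpow hC.le (hu.nonneg _)]
    exact Real.rpow_le_rpow (mul_nonneg (hu.nonneg _) (hu.nonneg _)) h hq.le
  log_bound := by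
    obtain ⟨D, hD, h⟩ := hu.log_bound
    refine ⟨q * D, by positivity, fun l hl => ?_⟩
    have hl' : 0 < u l := by
      rcases (hu.nonneg l).lt_or_eq with h0 | h0
      · exact h0
      · rw [← h0, Real.zero_rpow hq.ne'] at hl
        exact absurd hl (lt_irrefl _)
    rw [Real.log_rpow hl', abs_mul, abs_of_pos hq, mul_assoc]
    exact mul_le_mul_of_nonneg_left (h l hl') hq.le

theorem prefix_pos (hu : Weight u) {I J : List (Fin m)} (h : 0 < u (I ++ J)) : 0 < u I :=
  pos_of_mul_pos_left (h.trans_le (hu.append_le I J)) (hu.nonneg J)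

theorem suffix_pos (hu : Weight u) {I J : List (Fin m)} (h : 0 < u (I ++ J)) : 0 < u J :=
  pos_of_mul_pos_right (h.trans_le (hu.append_le I J)) (hu.nonneg I)

theorem nil_pos (hu : Weight u) : 0 < u [] := by
  obtain ⟨a, ha⟩ := hu.exists_letter
  exact hu.prefix_pos (J := [a]) ha

/-- Total weight of words extending `I` by `i` letters on the left and `j` on the right. -/
def flank (u : List (Fin m) → ℝ) (i j : ℕ) (I : List (Fin m)) : ℝ :=
  wordSum i fun U => wordSum j fun V => u (U ++ (I ++ V))

theorem wordSum_add_le (hu : Weight u) (n k : ℕ) :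
    wordSum (n + k) u ≤ wordSum n u * wordSum k u := by
  rw [wordSum_add, ← wordSum_mul_right]
  refine wordSum_le_wordSum fun I _ => ?_
  rw [← wordSum_mul_left]
  exact wordSum_le_wordSum fun J _ => hu.append_le I J

theorem flank_le (hu : Weight u) (i j : ℕ) (I : List (Fin m)) :
    flank u i j I ≤ wordSum i u * u I * wordSum j u := by
  unfold flank
  rw [mul_assoc, ← wordSum_mul_right]
  refine wordSum_le_wordSum fun U _ => ?_
  rw [← wordSum_mul_left, ← wordSum_mul_left]
  refine wordSum_le_wordSum fun V _ => ?_
  exact (hu.append_le _ _).trans (mul_le_mul_of_nonneg_left (hu.append_le _ _) (hu.nonneg _))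

theorem flank_add_le (hu : Weight u) (k i j l : ℕ) (I : List (Fin m)) :
    flank u (k + i) (j + l) I ≤ wordSum k u * flank u i j I * wordSum l u := by
  unfold flank
  rw [wordSum_add, mul_assoc, ← wordSum_mul_right]
  refine wordSum_le_wordSum fun A _ => ?_
  rw [← wordSum_mul_right, ← wordSum_mul_left]
  refine wordSum_le_wordSum fun U _ => ?_
  rw [wordSum_add, ← wordSum_mul_right, ← wordSum_mul_left]
  refine wordSum_le_wordSum fun V _ => ?_
  rw [← wordSum_mul_left, ← wordSum_mul_left]
  refine wordSum_le_wordSum fun B _ => ?_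
  have h1 := hu.append_le A ((U ++ (I ++ V)) ++ B)
  have h2 := hu.append_le (U ++ (I ++ V)) B
  simp only [List.append_assoc] at h1 h2 ⊢
  exact h1.trans (mul_le_mul_of_nonneg_left h2 (hu.nonneg _))

theorem exists_wordSum_le (hu : Weight u) (r : ℕ) : ∃ B : ℝ, 0 < B ∧ ∀ k ≤ r, wordSum k u ≤ B := by
  refine ⟨1 + ∑ k ∈ Finset.range (r + 1), wordSum k u, ?_, fun k hk => ?_⟩
  · have := Finset.sum_nonneg (s := Finset.range (r + 1)) (f := fun k => wordSum k u)
      fun k _ => wordSum_nonneg hu.nonneg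
    linarith
  · have := Finset.single_le_sum (s := Finset.range (r + 1)) (f := fun k => wordSum k u)
      (fun k _ => wordSum_nonneg hu.nonneg) (Finset.mem_range.2 (Nat.lt_succ_of_le hk))
    linarith

/-- Converse of `flank_le`. Connectors are inserted on both sides of `I`; since their lengths are
only known to be at most `r`, one sums over all lengths. The connectors lengthen the flanks, and
`flank_add_le` cuts the surplus outermost letters off again at bounded cost. -/
theorem exists_le_flank (hu : Weight u) : ∃ C : ℝ, 0 < C ∧ ∀ i j I,
    wordSum i u * u I * wordSum j u ≤ C * flank u i j I := by
  obtain ⟨C, hC, r, h⟩ := hu.connect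
  obtain ⟨B, hB, hZ⟩ := hu.exists_wordSum_le r
  have fl0 : ∀ i j I, 0 ≤ flank u i j I := fun i j I =>
    wordSum_nonneg fun _ => wordSum_nonneg fun _ => hu.nonneg _
  refine ⟨C * C * ((r + 1) * (r + 1) * (B * B)), by positivity, fun i j I => ?_⟩
  have key : ∀ U V, u U * u I * u V ≤ C * C * ∑ k ∈ Finset.range (r + 1),
      ∑ l ∈ Finset.range (r + 1), wordSum k fun K => wordSum l fun L =>
        u (U ++ (K ++ (I ++ (L ++ V)))) := by
    intro U V
    obtain ⟨K, hK, h1⟩ := h U I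
    obtain ⟨L, hL, h2⟩ := h (U ++ K ++ I) V
    have e1 : u U * u I * u V ≤ C * C * u (U ++ (K ++ (I ++ (L ++ V)))) := by
      calc u U * u I * u V ≤ C * u (U ++ K ++ I) * u V :=
            mul_le_mul_of_nonneg_right h1 (hu.nonneg _)
        _ = C * (u (U ++ K ++ I) * u V) := by ring
        _ ≤ C * (C * u (U ++ K ++ I ++ L ++ V)) := mul_le_mul_of_nonneg_left h2 hC.le
        _ = _ := by simp only [List.append_assoc]; ring
    refine e1.trans (mul_le_mul_of_nonneg_left ?_ (by positivity))
    have n1 : ∀ k l, 0 ≤ wordSum k fun K => wordSum l fun L =>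
        u (U ++ (K ++ (I ++ (L ++ V)))) := fun k l =>
      wordSum_nonneg fun _ => wordSum_nonneg fun _ => hu.nonneg _
    refine le_trans ?_ (Finset.single_le_sum (fun k _ => Finset.sum_nonneg fun l _ => n1 k l)
      (Finset.mem_range.2 (Nat.lt_succ_of_le hK)))
    refine le_trans ?_ (Finset.single_le_sum (fun l _ => n1 K.length l)
      (Finset.mem_range.2 (Nat.lt_succ_of_le hL)))
    refine le_trans ?_ (le_wordSum (fun _ => wordSum_nonneg fun _ => hu.nonneg _) K)
    exact le_wordSum (f := fun L => u (U ++ (K ++ (I ++ (L ++ V))))) (fun _ => hu.nonneg _) L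
  have e2 : wordSum i u * u I * wordSum j u ≤
      C * C * ∑ k ∈ Finset.range (r + 1), ∑ l ∈ Finset.range (r + 1),
        flank u (i + k) (l + j) I := by
    have : wordSum i u * u I * wordSum j u =
        wordSum i fun U => wordSum j fun V => u U * u I * u V := by
      simp only [wordSum_mul_left, wordSum_mul_right]
    rw [this]
    calc _ ≤ wordSum i fun U => wordSum j fun V => C * C * ∑ k ∈ Finset.range (r + 1),
          ∑ l ∈ Finset.range (r + 1), wordSum k fun K => wordSum l fun L =>
            u (U ++ (K ++ (I ++ (L ++ V)))) :=
          wordSum_le_wordSum fun U _ => wordSum_le_wordSum fun V _ => key U V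
      _ = _ := by
          simp only [wordSum_mul_left, wordSum_sum]
          congr 1
          refine Finset.sum_congr rfl fun k _ => Finset.sum_congr rfl fun l _ => ?_
          unfold flank
          rw [wordSum_add]
          refine wordSum_congr fun U _ => ?_
          rw [wordSum_comm]
          refine wordSum_congr fun K _ => ?_
          rw [wordSum_comm, wordSum_add]
          simp only [List.append_assoc]
  refine e2.trans ?_
  rw [mul_assoc (C * C)]
  refine mul_le_mul_of_nonneg_left ?_ (by positivity)
  have e3 : ∀ k ∈ Finset.range (r + 1), ∀ l ∈ Finset.range (r + 1),
      flank u (i + k) (l + j) I ≤ B * B * flank u i j I := by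
    intro k hk l hl
    rw [add_comm i, add_comm l]
    refine (hu.flank_add_le k i j l I).trans ?_
    have hk' := hZ k (Nat.lt_succ_iff.1 (Finset.mem_range.1 hk))
    have hl' := hZ l (Nat.lt_succ_iff.1 (Finset.mem_range.1 hl))
    calc _ ≤ B * flank u i j I * B := by
          gcongr
          · exact wordSum_nonneg hu.nonneg
          · exact mul_nonneg hB.le (fl0 _ _ _)
          · exact fl0 _ _ _
      _ = _ := by ring
  calc _ ≤ ∑ k ∈ Finset.range (r + 1), ∑ l ∈ Finset.range (r + 1), B * B * flank u i j I :=
        Finset.sum_le_sum fun k hk => Finset.sum_le_sum fun l hl => e3 k hk l hl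
    _ = _ := by
        simp only [Finset.sum_const, Finset.card_range, nsmul_eq_mul]
        push_cast
        ring

/-- The case of an empty middle word in `exists_le_flank`, whence the division by `u []`. -/
theorem exists_mul_wordSum_le (hu : Weight u) : ∃ C : ℝ, 0 < C ∧ ∀ n k,
    wordSum n u * wordSum k u ≤ C * wordSum (n + k) u := by
  obtain ⟨C, hC, h⟩ := hu.exists_le_flank
  refine ⟨C / u [], div_pos hC hu.nil_pos, fun n k => ?_⟩
  have h1 := h n k []
  have h2 : flank u n k [] = wordSum (n + k) u := by
    rw [wordSum_add]; simp [flank]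
  rw [h2] at h1
  rw [div_mul_eq_mul_div, le_div_iff₀ hu.nil_pos]
  linarith

theorem wordSum_pos (hu : Weight u) (n : ℕ) : 0 < wordSum n u := by
  obtain ⟨C, hC, h⟩ := hu.exists_mul_wordSum_le
  have h1 : 0 < wordSum 1 u := by
    obtain ⟨a, ha⟩ := hu.exists_letter
    exact ha.trans_le (le_wordSum hu.nonneg [a])
  induction n with
  | zero => rw [wordSum_zero]; exact hu.nil_pos
  | succ n ih =>
    have := h n 1
    exact pos_of_mul_pos_right ((mul_pos ih h1).trans_le this) hC.le

/-- The exponential growth rate of the total weight of the words of length `n`. -/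
def press (u : List (Fin m) → ℝ) : ℝ := limUnder atTop fun n : ℕ => Real.log (wordSum n u) / n

/-- The logarithm `a n` of the word sum is subadditive, and superadditive up to `log C`. Fekete's
lemma for `a n` and for `log C - a n` gives the same limit up to sign and confines `a n` to a
bounded distance from `n P`. -/
theorem exists_growth (hu : Weight u) : ∃ P C : ℝ, 0 < C ∧
    Tendsto (fun n : ℕ => Real.log (wordSum n u) / n) atTop (𝓝 P) ∧
    ∀ n : ℕ, Real.exp (n * P) ≤ wordSum n u ∧ wordSum n u ≤ C * Real.exp (n * P) := by
  obtain ⟨C, hC, h⟩ := hu.exists_mul_wordSum_le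
  have hp := hu.wordSum_pos
  set a : ℕ → ℝ := fun n => Real.log (wordSum n u) with ha
  have sub : Subadditive a := fun n k => by
    simp only [ha]
    rw [← Real.log_mul (hp n).ne' (hp k).ne']
    exact Real.log_le_log (hp _) (hu.wordSum_add_le n k)
  have sup : ∀ n k, a n + a k ≤ Real.log C + a (n + k) := fun n k => by
    simp only [ha]
    rw [← Real.log_mul (hp n).ne' (hp k).ne', ← Real.log_mul hC.ne' (hp _).ne']
    exact Real.log_le_log (mul_pos (hp _) (hp _)) (h n k)
  have sub' : Subadditive fun n => Real.log C - a n := fun n k => by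
    have := sup n k
    dsimp only
    linarith
  -- Crude linear bounds, needed only for the boundedness hypotheses of Fekete's lemma.
  have lin : ∀ n : ℕ, n * (a 1 - |Real.log C|) ≤ a n + |a 0| := by
    intro n
    induction n with
    | zero => simp; linarith [neg_abs_le (a 0)]
    | succ n ih =>
      have := sup n 1
      push_cast
      linarith [le_abs_self (Real.log C)]
  have lin' : ∀ n : ℕ, a n ≤ n * a 1 + |a 0| := by
    intro n
    induction n with
    | zero => simp; exact le_abs_self _
    | succ n ih =>
      have := sub n 1
      push_cast
      linarith
  have bd : BddBelow (Set.range fun n : ℕ => a n / n) := by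
    -- The `0` in the minimum covers `n = 0`, where the quotient is `0` by convention.
    refine ⟨min 0 ((a 1 - |Real.log C|) - |a 0|), ?_⟩
    rintro _ ⟨n, rfl⟩
    dsimp only
    rcases Nat.eq_zero_or_pos n with rfl | hn
    · simp
    · have hn1 : (1 : ℝ) ≤ n := by exact_mod_cast hn
      refine (min_le_right _ _).trans ?_
      rw [le_div_iff₀ (by positivity)]
      have := lin n
      nlinarith [abs_nonneg (a 0)]
  have bd' : BddBelow (Set.range fun n : ℕ => (Real.log C - a n) / n) := by
    refine ⟨min 0 (- |Real.log C| - a 1 - |a 0|), ?_⟩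
    rintro _ ⟨n, rfl⟩
    dsimp only
    rcases Nat.eq_zero_or_pos n with rfl | hn
    · simp
    · have hn1 : (1 : ℝ) ≤ n := by exact_mod_cast hn
      refine (min_le_right _ _).trans ?_
      rw [le_div_iff₀ (by positivity)]
      have := lin' n
      nlinarith [abs_nonneg (a 0), neg_abs_le (Real.log C), abs_nonneg (Real.log C)]
  have t1 := sub.tendsto_lim bd
  have t2 := sub'.tendsto_lim bd'
  have t3 : Tendsto (fun n : ℕ => (Real.log C - a n) / n) atTop (𝓝 (0 - sub.lim)) := by
    simp only [sub_div]
    exact (tendsto_const_div_atTop_nhds_zero_nat _).sub t1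
  have e := tendsto_nhds_unique t2 t3
  have hP : ∀ n : ℕ, n * sub.lim ≤ a n := by
    intro n
    rcases Nat.eq_zero_or_pos n with rfl | hn
    · have := sub 0 0
      simp at this ⊢
      exact this
    · have := sub.lim_le_div bd hn.ne'
      rw [le_div_iff₀ (by exact_mod_cast hn)] at this
      linarith
  have hP' : ∀ n : ℕ, a n ≤ |Real.log C| + n * sub.lim := by
    intro n
    rcases Nat.eq_zero_or_pos n with rfl | hn
    · have := sup 0 0
      simp at this ⊢
      linarith [le_abs_self (Real.log C)]
    · have := sub'.lim_le_div bd' hn.ne'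
      rw [le_div_iff₀ (by exact_mod_cast hn), e] at this
      linarith [le_abs_self (Real.log C)]
  refine ⟨sub.lim, Real.exp |Real.log C|, Real.exp_pos _, t1, fun n => ⟨?_, ?_⟩⟩
  · exact (Real.le_log_iff_exp_le (hp n)).1 (hP n)
  · rw [← Real.exp_add]
    exact (Real.log_le_iff_le_exp (hp n)).1 (hP' n)

theorem tendsto_press (hu : Weight u) :
    Tendsto (fun n : ℕ => Real.log (wordSum n u) / n) atTop (𝓝 (press u)) := by
  obtain ⟨P, C, _, h, _⟩ := hu.exists_growth
  rw [press, h.limUnder_eq]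
  exact h

theorem exists_wordSum_bounds (hu : Weight u) : ∃ C : ℝ, 0 < C ∧ ∀ n : ℕ,
    Real.exp (n * press u) ≤ wordSum n u ∧ wordSum n u ≤ C * Real.exp (n * press u) := by
  obtain ⟨P, C, hC, h, hb⟩ := hu.exists_growth
  rw [press, h.limUnder_eq]
  exact ⟨C, hC, hb⟩

end Weight

/-! ### Cylinders and finite measures on the space of sequences -/

section Symbolic

variable {m : ℕ}

/-- The first `n` letters of a sequence. -/
def pre (x : ℕ → Fin m) (n : ℕ) : List (Fin m) := List.ofFn fun k : Fin n => x k

/-- The shift map on all sequences. -/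
def seqShift (x : ℕ → Fin m) : ℕ → Fin m := fun k => x (k + 1)

/-- The set of sequences starting with the word `l`. -/
def cyl (l : List (Fin m)) : Set (ℕ → Fin m) := {x | pre x l.length = l}

@[simp]
theorem length_pre (x : ℕ → Fin m) (n : ℕ) : (pre x n).length = n := by
  simp [pre]

@[simp]
theorem pre_zero (x : ℕ → Fin m) : pre x 0 = [] := by
  simp [pre]

theorem seqShift_iterate (n : ℕ) (x : ℕ → Fin m) (k : ℕ) : seqShift^[n] x k = x (n + k) := by
  induction n generalizing x with
  | zero => simp
  | succ n ih => rw [Function.iterate_succ_apply, ih, seqShift, Nat.succ_add]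

theorem pre_add (x : ℕ → Fin m) (n k : ℕ) :
    pre x (n + k) = pre x n ++ pre (seqShift^[n] x) k := by
  simp [pre, List.ofFn_add, seqShift_iterate]

theorem pre_eq_pre_iff {x y : ℕ → Fin m} {n : ℕ} : pre x n = pre y n ↔ ∀ k < n, x k = y k := by
  unfold pre
  rw [List.ofFn_inj, funext_iff]
  exact Fin.forall_iff

theorem mem_cyl {l : List (Fin m)} {x : ℕ → Fin m} : x ∈ cyl l ↔ pre x l.length = l := Iff.rfl

theorem mem_cyl_pre (x : ℕ → Fin m) (n : ℕ) : x ∈ cyl (pre x n) := by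
  simp [mem_cyl]

theorem mem_cyl_append {I J : List (Fin m)} {x : ℕ → Fin m} :
    x ∈ cyl (I ++ J) ↔ x ∈ cyl I ∧ seqShift^[I.length] x ∈ cyl J := by
  simp only [mem_cyl, List.length_append, pre_add]
  exact List.append_inj' (s₁ := pre x I.length) (s₂ := I) |> fun h =>
    ⟨fun e => h e (by simp), fun e => by rw [e.1, e.2]⟩

theorem mem_cyl_ofFn {n : ℕ} {J : Fin n → Fin m} {x : ℕ → Fin m} :
    x ∈ cyl (List.ofFn J) ↔ (fun k : Fin n => x k) = J := by
  rw [mem_cyl, List.length_ofFn, pre, List.ofFn_inj]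

theorem continuous_restrict (n : ℕ) :
    Continuous fun (x : ℕ → Fin m) (k : Fin n) => x k := by
  fun_prop

theorem isClopen_cyl (l : List (Fin m)) : IsClopen (cyl l) := by
  have : cyl l = (fun (x : ℕ → Fin m) (k : Fin l.length) => x k) ⁻¹' {l.get} := by
    ext x
    conv_lhs => rw [← List.ofFn_get l]
    rw [mem_cyl_ofFn]
    rfl
  rw [this]
  exact (isClopen_discrete _).preimage (continuous_restrict _)

theorem measurableSet_cyl (l : List (Fin m)) : MeasurableSet (cyl l) :=
  (isClopen_cyl l).isOpen.measurableSet

theorem continuous_seqShift : Continuous (seqShift (m := m)) := by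
  unfold seqShift
  fun_prop

theorem measurable_seqShift : Measurable (seqShift (m := m)) := continuous_seqShift.measurable

theorem measurable_comp_pre {β : Type*} [MeasurableSpace β] (f : List (Fin m) → β) (n : ℕ) :
    Measurable fun x : ℕ → Fin m => f (pre x n) :=
  (measurable_of_countable fun J : Fin n → Fin m => f (List.ofFn J)).comp
    (continuous_restrict n).measurable

theorem integral_comp_pre (μ : Measure (ℕ → Fin m)) [IsFiniteMeasure μ]
    (f : List (Fin m) → ℝ) (n : ℕ) :
    ∫ x, f (pre x n) ∂μ = wordSum n fun l => μ.real (cyl l) * f l := by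
  have h := (continuous_restrict (m := m) n).measurable
  have e : ∫ x, f (pre x n) ∂μ = ∫ J, f (List.ofFn J)
      ∂(μ.map fun (x : ℕ → Fin m) (k : Fin n) => x k) := by
    rw [integral_map h.aemeasurable (measurable_of_countable _).aestronglyMeasurable]
    rfl
  rw [e, integral_fintype (Integrable.of_finite)]
  refine Finset.sum_congr rfl fun J _ => ?_
  rw [smul_eq_mul, map_measureReal_apply h (measurableSet_singleton _)]
  congr 2
  ext x
  rw [mem_cyl_ofFn]
  rfl

theorem integrable_comp_pre (μ : Measure (ℕ → Fin m)) [IsFiniteMeasure μ]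
    (f : List (Fin m) → ℝ) (n : ℕ) : Integrable (fun x => f (pre x n)) μ := by
  refine Integrable.of_bound (measurable_comp_pre f n).aestronglyMeasurable
    (∑ J : Fin n → Fin m, |f (List.ofFn J)|) (Eventually.of_forall fun x => ?_)
  exact Finset.single_le_sum (f := fun J : Fin n → Fin m => |f (List.ofFn J)|)
    (fun _ _ => abs_nonneg _) (Finset.mem_univ fun k : Fin n => x k)

theorem exists_cyl_subset {U : Set (ℕ → Fin m)} (hU : IsOpen U) {x : ℕ → Fin m} (hx : x ∈ U) :
    ∃ n, cyl (pre x n) ⊆ U := by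
  obtain ⟨s, ⟨y, n, rfl⟩, hxs, hsU⟩ :=
    (PiNat.isTopologicalBasis_cylinders fun _ : ℕ => Fin m).exists_subset_of_mem_open hx hU
  refine ⟨n, fun z hz => hsU ?_⟩
  rw [mem_cyl, length_pre, pre_eq_pre_iff] at hz
  intro k hk
  rw [hz k hk]
  exact hxs k hk

/-- An open set is the increasing union of the sets `V n`, each a finite disjoint union of cylinders
of order `n`; outer regularity then passes from open sets to all sets. -/
theorem Measure.le_of_le_cyl {ρ ν : Measure (ℕ → Fin m)} [IsFiniteMeasure ρ] [IsFiniteMeasure ν]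
    (h : ∀ l, ρ (cyl l) ≤ ν (cyl l)) : ρ ≤ ν := by
  classical
  have hopen : ∀ U : Set (ℕ → Fin m), IsOpen U → ρ U ≤ ν U := by
    intro U hU
    set V : ℕ → Set (ℕ → Fin m) := fun n => {x | cyl (pre x n) ⊆ U} with hV
    have hVU : U = ⋃ n, V n := by
      ext x
      simp only [Set.mem_iUnion]
      exact ⟨fun hx => exists_cyl_subset hU hx, fun ⟨n, hn⟩ => hn (mem_cyl_pre x n)⟩
    have hmono : Monotone V := by
      intro n k hnk x hx
      obtain ⟨j, rfl⟩ := Nat.exists_eq_add_of_le hnk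
      refine Set.Subset.trans ?_ hx
      intro y hy
      rw [pre_add] at hy
      exact (mem_cyl_append.1 hy).1
    have hVn : ∀ n, V n = ⋃ J ∈ Finset.univ.filter
        (fun J : Fin n → Fin m => cyl (List.ofFn J) ⊆ U), cyl (List.ofFn J) := by
      intro n
      ext x
      simp only [Set.mem_iUnion, Finset.mem_filter, Finset.mem_univ, true_and, exists_prop]
      constructor
      · intro hx
        exact ⟨fun k => x k, hx, mem_cyl_pre x n⟩
      · rintro ⟨J, hJ, hx⟩
        rw [mem_cyl_ofFn] at hx
        subst hx
        exact hJ
    have hdisj : ∀ n, ∀ s : Set (Fin n → Fin m),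
        s.PairwiseDisjoint fun J => cyl (List.ofFn J) := by
      intro n s J _ K _ hJK
      rw [Function.onFun, Set.disjoint_left]
      intro x hx hx'
      rw [mem_cyl_ofFn] at hx hx'
      exact hJK (hx.symm.trans hx')
    rw [hVU, hmono.measure_iUnion, hmono.measure_iUnion]
    refine iSup_mono fun n => ?_
    rw [hVn, measure_biUnion_finset (hdisj n _) fun _ _ => measurableSet_cyl _,
      measure_biUnion_finset (hdisj n _) fun _ _ => measurableSet_cyl _]
    exact Finset.sum_le_sum fun J _ => h _
  refine Measure.le_iff'.2 fun s => ?_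
  rw [s.measure_eq_iInf_isOpen ν]
  exact le_iInf₂ fun U hsU => le_iInf fun hU => (measure_mono hsU).trans (hopen U hU)

end Symbolic

/-! ### Construction of Gibbs measures -/

/-- A shift-invariant probability measure giving each cylinder a mass comparable to its
normalized weight. -/
structure IsGibbs {m : ℕ} (u : List (Fin m) → ℝ) (μ : Measure (ℕ → Fin m)) : Prop where
  prob : IsProbabilityMeasure μ
  inv : MeasurePreserving seqShift μ μ
  lower : ∃ c : ℝ, 0 < c ∧ ∀ l : List (Fin m),
    c * (Real.exp (-(l.length * Weight.press u)) * u l) ≤ μ.real (cyl l)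
  upper : ∃ C : ℝ, 0 < C ∧ ∀ l : List (Fin m),
    μ.real (cyl l) ≤ C * (Real.exp (-(l.length * Weight.press u)) * u l)

section Construction

variable {m : ℕ}

/-- The sequence starting with `l` and continuing with the constant letter `a`. -/
def pad (a : Fin m) (l : List (Fin m)) : ℕ → Fin m := fun k => l.getD k a

theorem pre_shift_pad (a : Fin m) (U I V : List (Fin m)) :
    pre (seqShift^[U.length] (pad a (U ++ (I ++ V)))) I.length = I := by
  apply List.ext_getElem
  · simp
  · intro k h1 h2
    simp only [pre, List.getElem_ofFn, seqShift_iterate, pad]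
    simp only [List.getD_eq_getElem?_getD]
    rw [List.getElem?_append_right (by omega), Nat.add_sub_cancel_left,
      List.getElem?_append_left h2]
    simp [h2]

/-- The average over the first `N + 1` shifts of the weighted point masses at words
of length `2 (N + 1)`. -/
def approx (u : List (Fin m) → ℝ) (a : Fin m) (N : ℕ) : Measure (ℕ → Fin m) :=
  ENNReal.ofReal (((N + 1 : ℕ) * wordSum (2 * (N + 1)) u)⁻¹) •
    ∑ i ∈ Finset.range (N + 1), ∑ J : Fin (2 * (N + 1)) → Fin m,
      ENNReal.ofReal (u (List.ofFn J)) • Measure.dirac (seqShift^[i] (pad a (List.ofFn J)))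

open Classical in
theorem approx_real {u : List (Fin m) → ℝ} (hu : ∀ l, 0 ≤ u l) (a : Fin m) (N : ℕ)
    {S : Set (ℕ → Fin m)} (hS : MeasurableSet S) :
    (approx u a N).real S = ((N + 1 : ℕ) * wordSum (2 * (N + 1)) u)⁻¹ *
      ∑ i ∈ Finset.range (N + 1), wordSum (2 * (N + 1)) fun l =>
        if seqShift^[i] (pad a l) ∈ S then u l else 0 := by
  have h0 : 0 ≤ ((N + 1 : ℕ) * wordSum (2 * (N + 1)) u)⁻¹ :=
    inv_nonneg.2 (mul_nonneg (Nat.cast_nonneg _) (wordSum_nonneg hu))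
  rw [Measure.real, approx, Measure.smul_apply, smul_eq_mul, ENNReal.toReal_mul,
    ENNReal.toReal_ofReal h0]
  have hfin : ∀ (l : List (Fin m)) (y : ℕ → Fin m),
      ENNReal.ofReal (u l) * S.indicator 1 y < ⊤ := by
    intro l y
    by_cases h : y ∈ S <;> simp [h]
  have hval : ∀ (l : List (Fin m)) (y : ℕ → Fin m),
      (ENNReal.ofReal (u l) * S.indicator 1 y).toReal = if y ∈ S then u l else 0 := by
    intro l y
    by_cases h : y ∈ S <;> simp [h, hu]
  congr 1
  simp only [Measure.finsetSum_apply, Measure.smul_apply, Measure.dirac_apply' _ hS, smul_eq_mul]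
  rw [ENNReal.toReal_sum fun i _ => (ENNReal.sum_lt_top.2 fun J _ => hfin _ _).ne]
  refine Finset.sum_congr rfl fun i _ => ?_
  rw [ENNReal.toReal_sum fun J _ => (hfin _ _).ne]
  exact Finset.sum_congr rfl fun J _ => hval _ _

end Construction

namespace Weight

variable {m : ℕ} {u : List (Fin m) → ℝ}

theorem isProbabilityMeasure_approx (hu : Weight u) (a : Fin m) (N : ℕ) :
    IsProbabilityMeasure (approx u a N) := by
  have h := approx_real hu.nonneg a N MeasurableSet.univ
  have hz := hu.wordSum_pos (2 * (N + 1))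
  have e : (approx u a N).real Set.univ = 1 := by
    rw [h]
    simp only [Set.mem_univ, if_true, Finset.sum_const, Finset.card_range, nsmul_eq_mul]
    exact inv_mul_cancel₀ (mul_pos (by positivity) hz).ne'
  refine ⟨?_⟩
  rw [Measure.real, ENNReal.toReal_eq_one_iff] at e
  exact e

/-- As `i ≤ N` and `I.length ≤ N`, the window read after `i` shifts lies inside the word of length
`2 (N + 1)`, so the padding letter plays no role and the words showing `I` at position `i` are
exactly those counted by `flank`. -/
theorem approx_cyl (hu : Weight u) (a : Fin m) (N : ℕ) (I : List (Fin m)) (hI : I.length ≤ N) :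
    (approx u a N).real (cyl I) = ((N + 1 : ℕ) * wordSum (2 * (N + 1)) u)⁻¹ *
      ∑ i ∈ Finset.range (N + 1), flank u i (2 * (N + 1) - i - I.length) I := by
  classical
  rw [approx_real hu.nonneg a N (measurableSet_cyl I)]
  congr 1
  refine Finset.sum_congr rfl fun i hi => ?_
  have hi' := Finset.mem_range.1 hi
  obtain ⟨j, hj⟩ : ∃ j, 2 * (N + 1) = i + (I.length + j) :=
    ⟨2 * (N + 1) - i - I.length, by omega⟩
  have hj' : 2 * (N + 1) - i - I.length = j := by omega
  rw [hj', hj, wordSum_add, flank]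
  refine wordSum_congr fun U hU => ?_
  rw [wordSum_add, ← wordSum_ite_eq I (wordSum j fun V => u (U ++ (I ++ V)))]
  refine wordSum_congr fun I' hI' => ?_
  have e : ∀ V : List (Fin m),
      seqShift^[i] (pad a (U ++ (I' ++ V))) ∈ cyl I ↔ I' = I := by
    intro V
    rw [mem_cyl, ← hI', ← hU, pre_shift_pad]
  simp only [e]
  by_cases h : I' = I
  · simp [h]
  · simp [h, wordSum]

/-- Each flank is comparable to `exp (i P) * u I * exp (j P)` with `i + I.length + j = 2 (N + 1)`,
hence to `exp (-(I.length P)) * u I` times the normalizing sum. The constants do not depend on `N`,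
so the bounds survive the limit. -/
theorem exists_approx_bounds (hu : Weight u) (a : Fin m) : ∃ c C : ℝ, 0 < c ∧ 0 < C ∧
    ∀ (I : List (Fin m)) (N : ℕ), I.length ≤ N →
      c * (Real.exp (-(I.length * press u)) * u I) ≤ (approx u a N).real (cyl I) ∧
      (approx u a N).real (cyl I) ≤ C * (Real.exp (-(I.length * press u)) * u I) := by
  obtain ⟨B, hB, hZ⟩ := hu.exists_wordSum_bounds
  obtain ⟨C, hC, hf⟩ := hu.exists_le_flank
  refine ⟨(C * B)⁻¹, B * B, by positivity, by positivity, fun I N hN => ?_⟩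
  rw [hu.approx_cyl a N I hN]
  have hz := hu.wordSum_pos (2 * (N + 1))
  set Z := wordSum (2 * (N + 1)) u with hZdef
  set P := press u
  set E := Real.exp (-(I.length * P)) with hE
  have hEpos : 0 < E := Real.exp_pos _
  have hexp : ∀ i j : ℕ, i + (I.length + j) = 2 * (N + 1) →
      Real.exp (i * P) * Real.exp (j * P) = Real.exp ((2 * (N + 1) : ℕ) * P) * E := by
    intro i j h
    rw [hE, ← Real.exp_add, ← Real.exp_add, ← h]
    congr 1
    push_cast
    ring
  have hN0 : (0 : ℝ) < (N + 1 : ℕ) := by positivity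
  have huI := hu.nonneg I
  have hb := hZ (2 * (N + 1))
  have hfl : ∀ i ∈ Finset.range (N + 1),
      (C * B)⁻¹ * (E * u I) * Z ≤ flank u i (2 * (N + 1) - i - I.length) I ∧
      flank u i (2 * (N + 1) - i - I.length) I ≤ B * B * (E * u I) * Z := by
    intro i hi
    have hi' := Finset.mem_range.1 hi
    set j := 2 * (N + 1) - i - I.length with hj
    have he := hexp i j (by omega)
    have zi := hZ i
    have zj := hZ j
    constructor
    · have h1 := hf i j I
      have h2 : Real.exp (i * P) * u I * Real.exp (j * P) ≤ C * flank u i j I := by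
        refine le_trans ?_ h1
        gcongr
        · exact mul_nonneg (wordSum_nonneg hu.nonneg) huI
        · exact zi.1
        · exact zj.1
      have h3 : E * u I * Z ≤ B * (Real.exp (i * P) * u I * Real.exp (j * P)) := by
        calc E * u I * Z ≤ E * u I * (B * Real.exp ((2 * (N + 1) : ℕ) * P)) :=
              mul_le_mul_of_nonneg_left hb.2 (by positivity)
          _ = B * u I * (Real.exp ((2 * (N + 1) : ℕ) * P) * E) := by ring
          _ = _ := by rw [← he]; ring
      rw [mul_assoc, inv_mul_le_iff₀ (by positivity)]
      calc _ ≤ _ := h3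
        _ ≤ B * (C * flank u i j I) := mul_le_mul_of_nonneg_left h2 hB.le
        _ = _ := by ring
    · calc flank u i j I ≤ wordSum i u * u I * wordSum j u := hu.flank_le i j I
        _ ≤ (B * Real.exp (i * P)) * u I * (B * Real.exp (j * P)) := by
            gcongr
            · exact (wordSum_nonneg hu.nonneg)
            · exact zi.2
            · exact zj.2
        _ = B * B * u I * (Real.exp (i * P) * Real.exp (j * P)) := by ring
        _ = B * B * (E * u I) * Real.exp ((2 * (N + 1) : ℕ) * P) := by rw [he]; ring
        _ ≤ _ := mul_le_mul_of_nonneg_left hb.1 (by positivity)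
  have hlo := Finset.card_nsmul_le_sum _ _ _ fun i hi => (hfl i hi).1
  have hhi := Finset.sum_le_card_nsmul _ _ _ fun i hi => (hfl i hi).2
  rw [Finset.card_range, nsmul_eq_mul] at hlo hhi
  constructor
  · rw [le_inv_mul_iff₀ (mul_pos hN0 hz)]
    calc _ = _ := by ring
      _ ≤ _ := hlo
  · rw [inv_mul_le_iff₀ (mul_pos hN0 hz)]
    calc _ ≤ _ := hhi
      _ = _ := by ring

/-- The difference telescopes to two terms out of an average of `N + 1`. -/
theorem approx_shift_le (hu : Weight u) (a : Fin m) (N : ℕ) {S : Set (ℕ → Fin m)}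
    (hS : MeasurableSet S) :
    |(approx u a N).real (seqShift ⁻¹' S) - (approx u a N).real S| ≤ 1 / ((N : ℝ) + 1) := by
  classical
  rw [approx_real hu.nonneg a N hS, approx_real hu.nonneg a N (measurable_seqShift hS), ← mul_sub]
  have hz := hu.wordSum_pos (2 * (N + 1))
  set Z := wordSum (2 * (N + 1)) u
  set b : ℕ → ℝ := fun i => wordSum (2 * (N + 1)) fun l =>
        if seqShift^[i] (pad a l) ∈ S then u l else 0 with hb
  have e : ∀ i, (wordSum (2 * (N + 1)) fun l =>
        if seqShift^[i] (pad a l) ∈ seqShift ⁻¹' S then u l else 0) = b (i + 1) := by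
    intro i
    simp only [hb, Set.mem_preimage, ← Function.iterate_succ_apply' seqShift]
  simp only [e]
  rw [← Finset.sum_sub_distrib, Finset.sum_range_sub]
  have hbb : ∀ i, 0 ≤ b i ∧ b i ≤ Z := by
    intro i
    constructor
    · refine wordSum_nonneg fun l => ?_
      split_ifs
      · exact hu.nonneg l
      · exact le_rfl
    · refine wordSum_le_wordSum fun l _ => ?_
      split_ifs
      · exact le_rfl
      · exact hu.nonneg l
  have h1 : |b (N + 1) - b 0| ≤ Z := by
    rw [abs_le]
    constructor <;> linarith [hbb 0, hbb (N + 1)]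
  rw [abs_mul, abs_of_pos (by positivity), inv_mul_le_iff₀ (by positivity)]
  refine h1.trans (le_of_eq ?_)
  push_cast
  field_simp

/-- Weak compactness along an ultrafilter. Cylinders are clopen, so their masses converge, and the
uniform bounds and the asymptotic invariance pass to the limit. -/
theorem exists_isGibbs (hu : Weight u) : ∃ μ : Measure (ℕ → Fin m), IsGibbs u μ := by
  obtain ⟨a, -⟩ := hu.exists_letter
  obtain ⟨c, C, hc, hC, hbd⟩ := hu.exists_approx_bounds a
  let ν : ℕ → ProbabilityMeasure (ℕ → Fin m) := fun N =>
    ⟨approx u a N, hu.isProbabilityMeasure_approx a N⟩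
  let F : Ultrafilter ℕ := hyperfilter ℕ
  obtain ⟨μ, -, hμ⟩ := isCompact_univ.ultrafilter_le_nhds (F.map ν) (by simp)
  have hFtop : (F : Filter ℕ) ≤ atTop := Nat.hyperfilter_le_atTop
  have hlim : Tendsto ν F (𝓝 μ) := hμ
  have hcl : ∀ S : Set (ℕ → Fin m), IsClopen S →
      Tendsto (fun N => (approx u a N).real S) F (𝓝 ((μ : Measure (ℕ → Fin m)).real S)) := by
    intro S hS
    have := ProbabilityMeasure.tendsto_measure_of_null_frontier_of_tendsto' hlim (E := S)
      (by rw [hS.frontier_eq]; simp)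
    exact (ENNReal.tendsto_toReal (measure_ne_top _ _)).comp this
  refine ⟨μ, inferInstance, ⟨measurable_seqShift, ?_⟩, ⟨c, hc, fun l => ?_⟩, ⟨C, hC, fun l => ?_⟩⟩
  · have key : ∀ l, (μ : Measure (ℕ → Fin m)).map seqShift (cyl l) =
        (μ : Measure (ℕ → Fin m)) (cyl l) := by
      intro l
      rw [Measure.map_apply measurable_seqShift (measurableSet_cyl l)]
      have h1 := hcl _ (isClopen_cyl l)
      have h2 := hcl _ ((isClopen_cyl l).preimage continuous_seqShift)
      have h3 : Tendsto (fun N => (approx u a N).real (seqShift ⁻¹' cyl l) -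
          (approx u a N).real (cyl l)) F (𝓝 0) := by
        refine squeeze_zero_norm (fun N => hu.approx_shift_le a N (measurableSet_cyl l)) ?_
        exact (tendsto_one_div_add_atTop_nhds_zero_nat (𝕜 := ℝ)).mono_left hFtop
      have h4 := tendsto_nhds_unique (h2.sub h1) h3
      exact (measureReal_eq_measureReal_iff).1 (sub_eq_zero.1 h4)
    have : IsProbabilityMeasure ((μ : Measure (ℕ → Fin m)).map seqShift) :=
      Measure.isProbabilityMeasure_map measurable_seqShift.aemeasurable
    exact le_antisymm (Measure.le_of_le_cyl fun l => (key l).le)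
      (Measure.le_of_le_cyl fun l => (key l).ge)
  · refine ge_of_tendsto (hcl _ (isClopen_cyl l)) ?_
    filter_upwards [hFtop (eventually_ge_atTop l.length)] with N hN using (hbd l N hN).1
  · refine le_of_tendsto (hcl _ (isClopen_cyl l)) ?_
    filter_upwards [hFtop (eventually_ge_atTop l.length)] with N hN using (hbd l N hN).2

end Weight

/-! ### The mean ergodic theorem in `L¹` -/

section MeanErgodic

variable {Ω : Type*} [MeasurableSpace Ω] {μ : Measure Ω} {T : Ω → Ω} {f : Ω → ℝ}

theorem memLp_birkhoffSum (hT : MeasurePreserving T μ μ) (hf : MemLp f 2 μ) (N : ℕ) :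
    MemLp (birkhoffSum T f N) 2 μ := by
  have : birkhoffSum T f N = fun x => ∑ k ∈ Finset.range N, (f ∘ T^[k]) x := rfl
  rw [this]
  exact memLp_finsetSum _ fun k _ => hf.comp_measurePreserving (hT.iterate k)

theorem memLp_birkhoffAverage (hT : MeasurePreserving T μ μ) (hf : MemLp f 2 μ) (N : ℕ) :
    MemLp (birkhoffAverage ℝ T f N) 2 μ :=
  (memLp_birkhoffSum hT hf N).const_smul (N : ℝ)⁻¹

theorem birkhoffSum_koopman (hT : MeasurePreserving T μ μ) (hf : MemLp f 2 μ) (N : ℕ) :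
    birkhoffSum (Lp.compMeasurePreserving T hT) id N (hf.toLp f) =
      (memLp_birkhoffSum hT hf N).toLp _ := by
  induction N with
  | zero =>
    rw [birkhoffSum_zero]
    have h0 : ∀ (g : Ω → ℝ) (hg : MemLp g 2 μ), g = 0 → (0 : Lp ℝ 2 μ) = hg.toLp g := by
      rintro _ hg rfl
      exact (MemLp.toLp_zero hg).symm
    exact h0 _ _ (funext fun x => birkhoffSum_zero T f x)
  | succ N ih =>
    rw [birkhoffSum_succ, ih, Lp.compMeasurePreserving_iterate, id,
      Lp.toLp_compMeasurePreserving, ← MemLp.toLp_add]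
    congr 1
    funext x
    simp [birkhoffSum_succ]

/-- **Von Neumann's mean ergodic theorem** in `L¹`, for an ergodic transformation. -/
theorem tendsto_integral_abs_birkhoffAverage_sub [IsProbabilityMeasure μ] (hT : Ergodic T μ)
    (hf : MemLp f 2 μ) :
    Tendsto (fun N => ∫ x, |birkhoffAverage ℝ T f N x - ∫ y, f y ∂μ| ∂μ) atTop (𝓝 0) := by
  have hT' := hT.toMeasurePreserving
  set U : Lp ℝ 2 μ →L[ℝ] Lp ℝ 2 μ :=
    (Lp.compMeasurePreservingₗᵢ ℝ T hT').toContinuousLinearMap with hU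
  have hUc : ∀ g, U g = Lp.compMeasurePreserving T hT' g := fun _ => rfl
  have hUn : ‖U‖ ≤ 1 := LinearIsometry.norm_toContinuousLinearMap_le _
  have hlim := U.tendsto_birkhoffAverage_orthogonalProjection hUn (hf.toLp f)
  set G := (U.eqLocus (1 : Lp ℝ 2 μ →L[ℝ] Lp ℝ 2 μ)).orthogonalProjectionOnto (hf.toLp f)
  have hG : U (G : Lp ℝ 2 μ) = G := G.2
  -- The limit `G` is the projection onto the fixed space of the Koopman operator, and ergodicity
  -- makes its elements constant.
  obtain ⟨c, hc⟩ : ∃ c : ℝ, (G : Lp ℝ 2 μ) =ᵐ[μ] Function.const Ω c := by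
    refine hT.ae_eq_const_of_ae_eq_comp_ae (Lp.aestronglyMeasurable _) ?_
    have h1 := Lp.coeFn_compMeasurePreserving (G : Lp ℝ 2 μ) hT'
    rw [← hUc, hG] at h1
    exact h1.symm
  have havg : ∀ N, birkhoffAverage ℝ U id N (hf.toLp f) =
      (memLp_birkhoffAverage hT' hf N).toLp _ := by
    intro N
    have := birkhoffSum_koopman hT' hf N
    rw [birkhoffAverage]
    change (N : ℝ)⁻¹ • birkhoffSum (Lp.compMeasurePreserving T hT') id N (hf.toLp f) = _
    rw [this, ← MemLp.toLp_const_smul]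
    rfl
  have hcm : MemLp (fun _ : Ω => c) 2 μ := memLp_const c
  have hGc : (G : Lp ℝ 2 μ) = hcm.toLp _ :=
    Lp.ext (hc.trans hcm.coeFn_toLp.symm)
  have hnorm : Tendsto (fun N => (eLpNorm (fun x => birkhoffAverage ℝ T f N x - c) 2 μ).toReal)
      atTop (𝓝 0) := by
    have h1 := tendsto_iff_norm_sub_tendsto_zero.1 hlim
    refine h1.congr fun N => ?_
    change ‖birkhoffAverage ℝ U id N (hf.toLp f) - (G : Lp ℝ 2 μ)‖ = _
    rw [havg, hGc, ← MemLp.toLp_sub, Lp.norm_toLp]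
    rfl
  have hL1 : Tendsto (fun N => ∫ x, |birkhoffAverage ℝ T f N x - c| ∂μ) atTop (𝓝 0) := by
    refine squeeze_zero (fun N => integral_nonneg fun _ => abs_nonneg _) (fun N => ?_) hnorm
    have hm := (memLp_birkhoffAverage hT' hf N).sub hcm
    have h1 : ∫ x, |birkhoffAverage ℝ T f N x - c| ∂μ =
        (eLpNorm (fun x => birkhoffAverage ℝ T f N x - c) 1 μ).toReal := by
      rw [eLpNorm_one_eq_lintegral_enorm]
      exact integral_norm_eq_lintegral_enorm hm.1
    rw [h1]
    exact ENNReal.toReal_mono hm.2.ne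
      (eLpNorm_le_eLpNorm_of_exponent_le one_le_two hm.1)
  have hint : ∀ N : ℕ, 0 < N → ∫ x, birkhoffAverage ℝ T f N x ∂μ = ∫ y, f y ∂μ := by
    intro N hN
    have hfi : Integrable f μ := hf.integrable one_le_two
    have e : ∀ k, ∫ x, f (T^[k] x) ∂μ = ∫ y, f y ∂μ := by
      intro k
      have hk := hT'.iterate k
      have h2 := integral_map (μ := μ) (φ := T^[k]) hk.measurable.aemeasurable (f := f)
        (by rw [hk.map_eq]; exact hfi.1)
      rw [hk.map_eq] at h2
      exact h2.symm
    simp only [birkhoffAverage, birkhoffSum, smul_eq_mul]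
    rw [integral_const_mul, integral_finsetSum]
    · simp only [e, Finset.sum_const, Finset.card_range, nsmul_eq_mul]
      field_simp
    · intro k _
      exact (hT'.iterate k).integrable_comp_of_integrable hfi
  -- All averages have the same integral as `f`, which identifies the constant.
  have hce : ∫ y, f y ∂μ = c := by
    have h1 : Tendsto (fun _ : ℕ => |∫ y, f y ∂μ - c|) atTop (𝓝 0) := by
      refine squeeze_zero' (Eventually.of_forall fun _ => abs_nonneg _) ?_ hL1
      filter_upwards [eventually_gt_atTop 0] with N hN
      have hi := (memLp_birkhoffAverage hT' hf N).integrable one_le_two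
      rw [← hint N hN]
      calc _ = |∫ x, (birkhoffAverage ℝ T f N x - c) ∂μ| := by
            rw [integral_sub hi (integrable_const c)]; simp
        _ ≤ _ := abs_integral_le_integral_abs
    have h2 := tendsto_nhds_unique h1 tendsto_const_nhds
    exact sub_eq_zero.1 (abs_eq_zero.1 h2.symm)
  rw [hce]
  exact hL1

end MeanErgodic

/-! ### Ergodicity of Gibbs measures -/

namespace IsGibbs

variable {m : ℕ} {u : List (Fin m) → ℝ} {μ : Measure (ℕ → Fin m)}

/-- The Gibbs bounds turn `Weight.connect` into a statement on measures; the sum over gaps accounts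
for a connector whose length depends on `I` and `J`. -/
theorem exists_mixing (hu : Weight u) (hμ : IsGibbs u μ) : ∃ κ : ℝ, 0 < κ ∧ ∃ r : ℕ, ∀ I J,
    κ * μ.real (cyl I) * μ.real (cyl J) ≤
      ∑ k ∈ Finset.range (r + 1), μ.real (cyl I ∩ seqShift^[I.length + k] ⁻¹' cyl J) := by
  have := hμ.prob
  obtain ⟨B, hB, r, hconn⟩ := hu.connect
  obtain ⟨c, hc, hlo⟩ := hμ.lower
  obtain ⟨C, hC, hhi⟩ := hμ.upper
  set P := Weight.press u
  set R := Real.exp (r * |P|)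
  have hR : 0 < R := Real.exp_pos _
  refine ⟨(C * C * B * R / c)⁻¹, by positivity, r, fun I J => ?_⟩
  obtain ⟨K, hK, h1⟩ := hconn I J
  have hKR : Real.exp (K.length * P) ≤ R := by
    apply Real.exp_le_exp.2
    have hk : (K.length : ℝ) ≤ r := by exact_mod_cast hK
    calc (K.length : ℝ) * P ≤ K.length * |P| := by gcongr; exact le_abs_self P
      _ ≤ r * |P| := by gcongr
  have hsub : cyl (I ++ K ++ J) ⊆ cyl I ∩ seqShift^[I.length + K.length] ⁻¹' cyl J := by
    intro x hx
    rw [mem_cyl_append, mem_cyl_append, List.length_append] at hx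
    exact ⟨hx.1.1, hx.2⟩
  have h2 : μ.real (cyl (I ++ K ++ J)) ≤
      ∑ k ∈ Finset.range (r + 1), μ.real (cyl I ∩ seqShift^[I.length + k] ⁻¹' cyl J) :=
    (measureReal_mono hsub).trans (Finset.single_le_sum
      (f := fun k => μ.real (cyl I ∩ seqShift^[I.length + k] ⁻¹' cyl J))
      (fun _ _ => measureReal_nonneg) (Finset.mem_range.2 (Nat.lt_succ_of_le hK)))
  refine le_trans ?_ h2
  rw [mul_assoc, inv_mul_le_iff₀ (by positivity)]
  have h3 := hlo (I ++ K ++ J)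
  have hexp : Real.exp (-(I.length * P)) * Real.exp (-(J.length * P)) =
      Real.exp (K.length * P) * Real.exp (-((I ++ K ++ J).length * P)) := by
    rw [← Real.exp_add, ← Real.exp_add]
    congr 1
    simp only [List.length_append]
    push_cast
    ring
  calc μ.real (cyl I) * μ.real (cyl J)
      ≤ (C * (Real.exp (-(I.length * P)) * u I)) * (C * (Real.exp (-(J.length * P)) * u J)) := by
        gcongr
        · exact mul_nonneg hC.le (mul_nonneg (Real.exp_pos _).le (hu.nonneg _))
        · exact hhi I
        · exact hhi J
    _ = C * C * (Real.exp (-(I.length * P)) * Real.exp (-(J.length * P))) * (u I * u J) := by ring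
    _ ≤ C * C * (R * Real.exp (-((I ++ K ++ J).length * P))) * (B * u (I ++ K ++ J)) := by
        rw [hexp]
        gcongr
        exact mul_nonneg (hu.nonneg _) (hu.nonneg _)
    _ = C * C * B * R / c * (c * (Real.exp (-((I ++ K ++ J).length * P)) * u (I ++ K ++ J))) := by
        field_simp
    _ ≤ _ := by gcongr

/-- For an invariant set `s`, comparison of measures on cylinders extends `exists_mixing` from `J`
to `s`, and then from `I` to `sᶜ`. This gives `κ μ(s) μ(sᶜ) ≤ (r + 1) μ(sᶜ ∩ s) = 0`. -/
theorem ergodic (hu : Weight u) (hμ : IsGibbs u μ) : Ergodic seqShift μ := by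
  have := hμ.prob
  obtain ⟨κ, hκ, r, hmix⟩ := hμ.exists_mixing hu
  refine ⟨hμ.inv, ⟨fun s hs hinv => ?_⟩⟩
  have hinvn : ∀ n, seqShift^[n] ⁻¹' s = s := by
    intro n
    induction n with
    | zero => rfl
    | succ n ih => rw [Function.iterate_succ, Set.preimage_comp, ih, hinv]
  have hiter : ∀ n, Measurable (seqShift^[n] : (ℕ → Fin m) → ℕ → Fin m) := fun n =>
    measurable_seqShift.iterate n
  have step1 : ∀ I, ENNReal.ofReal (κ * μ.real (cyl I)) * μ s ≤ (r + 1 : ℕ) * μ (cyl I ∩ s) := by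
    intro I
    set ρ : Measure (ℕ → Fin m) := ENNReal.ofReal (κ * μ.real (cyl I)) • μ
    set ν : Measure (ℕ → Fin m) := ∑ k ∈ Finset.range (r + 1),
      (μ.restrict (cyl I)).map seqShift^[I.length + k]
    have hν : ∀ B, MeasurableSet B → ν B =
        ∑ k ∈ Finset.range (r + 1), μ (cyl I ∩ seqShift^[I.length + k] ⁻¹' B) := by
      intro B hB
      rw [Measure.finsetSum_apply]
      refine Finset.sum_congr rfl fun k _ => ?_
      rw [Measure.map_apply (hiter _) hB, Measure.restrict_apply (hiter _ hB), Set.inter_comm]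
    have hρf : IsFiniteMeasure ρ := Measure.smul_finite μ ENNReal.ofReal_ne_top
    have hνf : IsFiniteMeasure ν := by
      refine ⟨?_⟩
      rw [hν _ MeasurableSet.univ, ENNReal.sum_lt_top]
      exact fun _ _ => measure_lt_top _ _
    have hle : ρ ≤ ν := by
      refine Measure.le_of_le_cyl fun J => ?_
      rw [hν _ (measurableSet_cyl J)]
      have h := hmix I J
      have e : ∀ A : Set (ℕ → Fin m), μ A = ENNReal.ofReal (μ.real A) := fun A =>
        (ofReal_measureReal (measure_ne_top _ _)).symm
      simp only [ρ, Measure.smul_apply, smul_eq_mul, e]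
      rw [← ENNReal.ofReal_mul (by positivity),
        ← ENNReal.ofReal_sum_of_nonneg fun _ _ => measureReal_nonneg]
      exact ENNReal.ofReal_le_ofReal h
    have h := hle s
    rw [hν s hs] at h
    simpa [hinvn, ρ] using h
  have step2 : (ENNReal.ofReal κ * μ s) • μ ≤ ((r + 1 : ℕ) : ENNReal) • μ.restrict s := by
    have f1 : IsFiniteMeasure ((ENNReal.ofReal κ * μ s) • μ) :=
      Measure.smul_finite μ (ENNReal.mul_ne_top ENNReal.ofReal_ne_top (measure_ne_top _ _))
    have f2 : IsFiniteMeasure (((r + 1 : ℕ) : ENNReal) • μ.restrict s) :=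
      Measure.smul_finite _ (ENNReal.natCast_ne_top _)
    refine Measure.le_of_le_cyl fun I => ?_
    have h := step1 I
    rw [ENNReal.ofReal_mul hκ.le, ofReal_measureReal (measure_ne_top _ _)] at h
    rw [Measure.smul_apply, Measure.smul_apply, Measure.restrict_apply (measurableSet_cyl I),
      smul_eq_mul, smul_eq_mul]
    refine le_trans (le_of_eq ?_) h
    ring
  have h0 := step2 sᶜ
  rw [Measure.smul_apply, Measure.smul_apply, Measure.restrict_apply hs.compl] at h0
  simp only [Set.compl_inter_self, measure_empty, smul_eq_mul, mul_zero, nonpos_iff_eq_zero,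
    mul_eq_zero, ENNReal.ofReal_eq_zero, not_le.2 hκ, false_or] at h0
  rw [Filter.eventuallyConst_set']
  rcases h0 with h | h
  · left
    exact ae_eq_empty.2 h
  · right
    exact ae_eq_univ.2 h

end IsGibbs

/-! ### The Lyapunov exponent of a Gibbs measure -/

namespace Weight

variable {m : ℕ} {w : List (Fin m) → ℝ}

theorem exists_abs_log_le (hw : Weight w) :
    ∃ D : ℝ, 0 ≤ D ∧ ∀ l, |Real.log (w l)| ≤ D * (l.length + 1) := by
  obtain ⟨D, hD, h⟩ := hw.log_bound
  refine ⟨D, hD, fun l => ?_⟩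
  rcases (hw.nonneg l).lt_or_eq with hl | hl
  · exact h l hl
  · rw [← hl, Real.log_zero, abs_zero]
    positivity

theorem pos_shift (hw : Weight w) {x : ℕ → Fin m} (hx : ∀ n, 0 < w (pre x n)) (n k : ℕ) :
    0 < w (pre (seqShift^[n] x) k) := by
  have h := hx (n + k)
  rw [pre_add] at h
  exact hw.suffix_pos h

theorem log_pre_add_le (hw : Weight w) {x : ℕ → Fin m} (hx : ∀ n, 0 < w (pre x n)) (n k : ℕ) :
    Real.log (w (pre x (n + k))) ≤
      Real.log (w (pre x n)) + Real.log (w (pre (seqShift^[n] x) k)) := by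
  rw [← Real.log_mul (hx n).ne' (hw.pos_shift hx n k).ne']
  refine Real.log_le_log (hx _) ?_
  rw [pre_add]
  exact hw.append_le _ _

/-- For each phase `j < n`, cut the sequence into blocks of length `n` starting at position `j`.
Summed over the phases, the full blocks start once at every position below `L * n`, which gives the
Birkhoff sum. The remaining terms bound the incomplete blocks at both ends and the empty word. -/
theorem mul_log_pre_le_birkhoffSum (hw : Weight w) {D : ℝ}
    (hD : ∀ l, |Real.log (w l)| ≤ D * (l.length + 1)) (hD0 : 0 ≤ D)
    {x : ℕ → Fin m} (hx : ∀ n, 0 < w (pre x n)) (n L : ℕ) :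
    n * Real.log (w (pre x ((L + 1) * n))) ≤
      birkhoffSum seqShift (fun y => Real.log (w (pre y n))) (L * n) x +
        (n * D + 2 * n * (D * (n + 1))) := by
  have hle : ∀ (y : ℕ → Fin m) (k : ℕ), k ≤ n → Real.log (w (pre y k)) ≤ D * (n + 1) := by
    intro y k hk
    refine (le_abs_self _).trans ((hD _).trans ?_)
    rw [length_pre]
    have : (k : ℝ) ≤ n := by exact_mod_cast hk
    gcongr
  have hF : ∑ j ∈ Finset.range n, Real.log (w (pre (seqShift^[j] x) (L * n))) ≤
      birkhoffSum seqShift (fun y => Real.log (w (pre y n))) (L * n) x + n * D := by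
    induction L with
    | zero =>
      simp only [zero_mul, pre_zero, birkhoffSum_zero, zero_add, Finset.sum_const,
        Finset.card_range, nsmul_eq_mul]
      have := (le_abs_self _).trans (hD [])
      simp only [List.length_nil, Nat.cast_zero, zero_add, mul_one] at this
      gcongr
    | succ L ih =>
      rw [Nat.succ_mul, birkhoffSum_add]
      have h1 : ∀ j ∈ Finset.range n, Real.log (w (pre (seqShift^[j] x) (L * n + n))) ≤
          Real.log (w (pre (seqShift^[j] x) (L * n))) +
            Real.log (w (pre (seqShift^[j] (seqShift^[L * n] x)) n)) := by
        intro j _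
        have h := hw.log_pre_add_le (hw.pos_shift hx j) (L * n) n
        rwa [← Function.iterate_add_apply, add_comm (L * n) j, Function.iterate_add_apply] at h
      refine (Finset.sum_le_sum h1).trans ?_
      rw [Finset.sum_add_distrib, birkhoffSum]
      unfold birkhoffSum at ih ⊢
      linarith
  have hj : ∀ j ∈ Finset.range n, Real.log (w (pre x ((L + 1) * n))) ≤
      Real.log (w (pre (seqShift^[j] x) (L * n))) + 2 * (D * (n + 1)) := by
    intro j hj
    have hjn := Finset.mem_range.1 hj
    have e : (L + 1) * n = j + (L * n + (n - j)) := by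
      rw [Nat.succ_mul]; omega
    rw [e]
    have h1 := hw.log_pre_add_le hx j (L * n + (n - j))
    have h2 := hw.log_pre_add_le (hw.pos_shift hx j) (L * n) (n - j)
    have h3 := hle x j hjn.le
    have h4 := hle (seqShift^[L * n] (seqShift^[j] x)) (n - j) (Nat.sub_le _ _)
    linarith
  have hs := Finset.sum_le_sum hj
  rw [Finset.sum_add_distrib] at hs
  simp only [Finset.sum_const, Finset.card_range, nsmul_eq_mul] at hs
  linarith

end Weight

namespace IsGibbs

variable {m : ℕ} {w : List (Fin m) → ℝ} {q : ℝ} {μ : Measure (ℕ → Fin m)}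

theorem ae_pos (hw : Weight w) (hq : 0 < q) (hμ : IsGibbs (fun l => w l ^ q) μ) :
    ∀ᵐ x ∂μ, ∀ n, 0 < w (pre x n) := by
  have := hμ.prob
  obtain ⟨C, hC, hhi⟩ := hμ.upper
  have h : ∀ l, w l = 0 → ∀ᵐ x ∂μ, x ∉ cyl l := by
    intro l hl
    rw [ae_iff]
    simp only [not_not]
    have h1 := hhi l
    rw [hl, Real.zero_rpow hq.ne', mul_zero, mul_zero] at h1
    exact (measureReal_eq_zero_iff (measure_ne_top _ _)).1 (le_antisymm h1 measureReal_nonneg)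
  have h2 : ∀ᵐ x ∂μ, ∀ l, w l = 0 → x ∉ cyl l := by
    rw [ae_all_iff]
    intro l
    by_cases hl : w l = 0
    · filter_upwards [h l hl] with x hx _ using hx
    · exact Eventually.of_forall fun x h0 => absurd h0 hl
  filter_upwards [h2] with x hx n
  exact (hw.nonneg _).lt_of_ne fun h0 => hx _ h0.symm (mem_cyl_pre x n)

/-- A weak form of Kingman's theorem, with `lam` the Fekete limit of the mean logarithms. Above
`lam`, the deviation is controlled by Birkhoff averages of a block of fixed length `n`; below, by
the fact that the mean is never less than `lam`. Lengths `N` divisible by `n` suffice for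
`exists_slope`. -/
theorem exists_exponent (hw : Weight w) (hq : 0 < q) (hμ : IsGibbs (fun l => w l ^ q) μ) :
    ∃ lam D : ℝ, |lam| ≤ D ∧ (∀ (N : ℕ) (x : ℕ → Fin m), |Real.log (w (pre x N)) / N| ≤ D) ∧
      ∀ η > 0, ∀ N₀ : ℕ, ∃ N ≥ N₀, 0 < N ∧
        ∫ x, |Real.log (w (pre x N)) / N - lam| ∂μ ≤ η := by
  have := hμ.prob
  obtain ⟨D, hD0, hD⟩ := hw.exists_abs_log_le
  have herg := hμ.ergodic (hw.rpow hq)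
  set X : ℕ → (ℕ → Fin m) → ℝ := fun n x => Real.log (w (pre x n)) with hX
  have hbound : ∀ (N : ℕ) (x : ℕ → Fin m), |X N x / N| ≤ 2 * D := by
    intro N x
    rcases Nat.eq_zero_or_pos N with rfl | hN
    · simp [hD0]
    · have hN1 : (1 : ℝ) ≤ N := by exact_mod_cast hN
      rw [abs_div, abs_of_pos (by linarith : (0 : ℝ) < N), div_le_iff₀ (by linarith)]
      have h := hD (pre x N)
      rw [length_pre] at h
      nlinarith
  have hmeas : ∀ n, Measurable (X n) := fun n =>
    measurable_comp_pre (fun l => Real.log (w l)) n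
  have hint : ∀ n, Integrable (X n) μ := fun n =>
    integrable_comp_pre μ (fun l => Real.log (w l)) n
  have hinv : ∀ n k, Integrable (fun x => X k (seqShift^[n] x)) μ ∧
      ∫ x, X k (seqShift^[n] x) ∂μ = ∫ x, X k x ∂μ := by
    intro n k
    have hn := hμ.inv.iterate n
    refine ⟨hn.integrable_comp_of_integrable (hint k), ?_⟩
    have h2 := integral_map (μ := μ) (φ := seqShift^[n]) hn.measurable.aemeasurable (f := X k)
      (hmeas k).aestronglyMeasurable
    rw [hn.map_eq] at h2
    exact h2.symm
  have hpos := hμ.ae_pos hw hq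
  set e : ℕ → ℝ := fun n => ∫ x, X n x ∂μ with he
  have hsub : Subadditive e := by
    intro n k
    simp only [he]
    rw [← (hinv n k).2, ← integral_add (hint n) (hinv n k).1]
    refine integral_mono_ae (hint _) ((hint n).add (hinv n k).1) ?_
    filter_upwards [hpos] with x hx using hw.log_pre_add_le hx n k
  have hediv : ∀ n : ℕ, |e n / n| ≤ 2 * D := by
    intro n
    have : e n / n = ∫ x, X n x / n ∂μ := (integral_div _ _).symm
    rw [this]
    have h := norm_integral_le_of_norm_le_const (μ := μ)
      (f := fun x => X n x / n) (C := 2 * D)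
      (Eventually.of_forall fun x => hbound n x)
    simpa using h
  have hbdd : BddBelow (Set.range fun n : ℕ => e n / n) := by
    refine ⟨-(2 * D), ?_⟩
    rintro _ ⟨n, rfl⟩
    exact (abs_le.1 (hediv n)).1
  have hlim := hsub.tendsto_lim hbdd
  set lam := hsub.lim
  refine ⟨lam, 2 * D, le_of_tendsto hlim.abs (Eventually.of_forall hediv), hbound,
    fun η hη N₀ => ?_⟩
  obtain ⟨n, hn1, hn⟩ : ∃ n : ℕ, 0 < n ∧ e n / n ≤ lam + η / 8 := by
    have h1 := hlim.eventually (ge_mem_nhds (show lam < lam + η / 8 by linarith))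
    obtain ⟨n, h2, h3⟩ := (h1.and (eventually_gt_atTop 0)).exists
    exact ⟨n, h3, h2⟩
  have hn0 : (0 : ℝ) < n := by exact_mod_cast hn1
  have hlamn : lam ≤ e n / n := hsub.lim_le_div hbdd hn1.ne'
  have hmem : MemLp (X n) 2 μ := by
    refine MemLp.of_bound (hmeas n).aestronglyMeasurable (D * (n + 1))
      (Eventually.of_forall fun x => ?_)
    have h := hD (pre x n)
    rwa [length_pre] at h
  have hmet := tendsto_integral_abs_birkhoffAverage_sub herg hmem
  set C' : ℝ := (n * D + 2 * n * (D * (n + 1))) / n + 2 * D * n with hC'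
  have hLn : Tendsto (fun L : ℕ => L * n) atTop atTop := tendsto_id.atTop_mul_const' hn1
  have ev1 := (hmet.comp hLn).eventually (ge_mem_nhds (show 0 < η / 8 * n by positivity))
  have ev2 : ∀ᶠ L : ℕ in atTop, C' / ((L * n : ℕ) : ℝ) ≤ η / 8 :=
    ((tendsto_const_div_atTop_nhds_zero_nat C').comp hLn).eventually
      (ge_mem_nhds (show 0 < η / 8 by positivity))
  obtain ⟨L, ⟨⟨hL1, hL2⟩, hL3⟩, hL4⟩ := (((ev1.and ev2).and
    (hLn.eventually_ge_atTop N₀)).and (eventually_gt_atTop 0)).exists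
  simp only [Function.comp] at hL1
  set M := L * n with hM
  have hM0 : (0 : ℝ) < M := by exact_mod_cast Nat.mul_pos hL4 hn1
  have hNM : (L + 1) * n = M + n := Nat.succ_mul L n
  refine ⟨(L + 1) * n, by omega, by positivity, ?_⟩
  set N := (L + 1) * n with hN
  have hN0 : (0 : ℝ) < N := by rw [hNM]; push_cast; positivity
  have hNr : (N : ℝ) = M + n := by rw [hNM]; push_cast; rfl
  set A := fun x => birkhoffAverage ℝ seqShift (X n) M x with hA
  have hAint : Integrable A μ :=
    (memLp_birkhoffAverage hμ.inv hmem M).integrable one_le_two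
  have hABS : Integrable (fun x => |A x - e n|) μ := (hAint.sub (integrable_const _)).abs
  -- If `z ≤ b` and `0 ≤ b`, then `|z| ≤ 2 b - z`; after integration, `-z` contributes at most zero.
  have hpt : ∀ᵐ x ∂μ, |X N x / N - lam| ≤
      2 * (|A x - e n| / n + ((e n / n - lam) + C' / M)) - (X N x / N - lam) := by
    filter_upwards [hpos] with x hx
    have h1 := hw.mul_log_pre_le_birkhoffSum hD hD0 hx n L
    have h2 : birkhoffSum seqShift (X n) M x = M * A x := by
      simp only [hA, birkhoffAverage, smul_eq_mul]
      field_simp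
    change n * X N x ≤ birkhoffSum seqShift (X n) M x + _ at h1
    rw [h2] at h1
    have h3 : X N x / M ≤ A x / n + (n * D + 2 * n * (D * (n + 1))) / n / M := by
      rw [div_le_iff₀ hM0]
      have : (A x / n + (n * D + 2 * n * (D * (n + 1))) / n / M) * M =
        (M * A x + (n * D + 2 * n * (D * (n + 1)))) / n := by field_simp
      rw [this, le_div_iff₀ hn0]
      linarith
    have h4 : X N x / N ≤ X N x / M + 2 * D * n / M := by
      have e1 : X N x / M = X N x / N * (1 + n / M) := by
        rw [hNr]; field_simp
      have h5 := (abs_le.1 (hbound N x)).1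
      rw [e1, mul_add, mul_one, mul_div_assoc, add_assoc, ← add_mul]
      have : 0 ≤ (n : ℝ) / M := by positivity
      nlinarith
    have h6 : A x / n ≤ |A x - e n| / n + e n / n := by
      rw [← add_div]
      gcongr
      linarith [le_abs_self (A x - e n)]
    have h7 : C' / M = (n * D + 2 * n * (D * (n + 1))) / n / M + 2 * D * n / M := by
      rw [hC', add_div]
    have h8 : 0 ≤ |A x - e n| / n := by positivity
    have h9 : 0 ≤ C' / M := by positivity
    rcases abs_cases (X N x / N - lam) with ⟨h, _⟩ | ⟨h, _⟩ <;> rw [h] <;> linarith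
  have i1 : Integrable (fun x => |A x - e n| / n) μ := hABS.div_const _
  have i2 : Integrable (fun x => |A x - e n| / n + ((e n / n - lam) + C' / M)) μ :=
    i1.add (integrable_const _)
  have i3 : Integrable (fun x => 2 * (|A x - e n| / n + ((e n / n - lam) + C' / M))) μ :=
    i2.const_mul 2
  have i4 : Integrable (fun x => X N x / N) μ := (hint N).div_const _
  have i5 : Integrable (fun x => X N x / N - lam) μ := i4.sub (integrable_const _)
  have hfin := integral_mono_ae i5.abs (i3.sub i5) hpt
  change _ ≤ ∫ x, (2 * (|A x - e n| / n + ((e n / n - lam) + C' / M)) - (X N x / N - lam)) ∂μ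
    at hfin
  rw [integral_sub i3 i5, integral_const_mul, integral_add i1 (integrable_const _), integral_div,
    integral_sub i4 (integrable_const _), integral_div] at hfin
  simp only [integral_const, probReal_univ, smul_eq_mul, one_mul] at hfin
  have hlamN : lam ≤ e N / N := hsub.lim_le_div hbdd (by positivity)
  have hI : (∫ x, |A x - e n| ∂μ) / n ≤ η / 8 := by
    rw [div_le_iff₀ hn0]
    exact hL1
  change ∫ x, |X N x / N - lam| ∂μ ≤ _ - (e N / N - lam) at hfin
  linarith

/-! ### Moments of the weight and subgradients of the pressure -/

theorem exists_moment_bounds (hw : Weight w) (hq : 0 < q) (hμ : IsGibbs (fun l => w l ^ q) μ) :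
    ∃ c : ℝ, 0 < c ∧ ∀ t, 0 < q + t → ∃ C : ℝ, 0 < C ∧ ∀ N : ℕ,
      c * Real.exp (N * (Weight.press (fun l => w l ^ (q + t)) -
        Weight.press (fun l => w l ^ q))) ≤ ∫ x, w (pre x N) ^ t ∂μ ∧
      ∫ x, w (pre x N) ^ t ∂μ ≤ C * Real.exp (N * (Weight.press (fun l => w l ^ (q + t)) -
        Weight.press (fun l => w l ^ q))) := by
  have := hμ.prob
  obtain ⟨c, hc, hlo⟩ := hμ.lower
  obtain ⟨C, hC, hhi⟩ := hμ.upper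
  -- The lower constant is fixed before `t`: `exists_slope` lets the exponent vary with `N`.
  refine ⟨c, hc, fun t ht => ?_⟩
  obtain ⟨B, hB, hZ⟩ := (hw.rpow ht).exists_wordSum_bounds
  set P := Weight.press (fun l => w l ^ q)
  set P' := Weight.press (fun l => w l ^ (q + t))
  have hmul : ∀ l, w l ^ q * w l ^ t = w l ^ (q + t) := by
    intro l
    rcases (hw.nonneg l).lt_or_eq with hl | hl
    · rw [Real.rpow_add hl]
    · rw [← hl, Real.zero_rpow hq.ne', Real.zero_rpow ht.ne', zero_mul]
  refine ⟨C * B, by positivity, fun N => ?_⟩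
  have hexp : Real.exp (N * (P' - P)) = Real.exp (-(N * P)) * Real.exp (N * P') := by
    rw [← Real.exp_add]; ring_nf
  rw [integral_comp_pre μ (fun l => w l ^ t) N, hexp]
  have hs : ∀ a : ℝ, (wordSum N fun l => a * (Real.exp (-(l.length * P)) * w l ^ q) * w l ^ t) =
      a * Real.exp (-(N * P)) * wordSum N fun l => w l ^ (q + t) := by
    intro a
    rw [← wordSum_mul_left]
    refine wordSum_congr fun l hl => ?_
    rw [← hmul, hl]
    ring
  constructor
  · calc _ = c * Real.exp (-(N * P)) * Real.exp (N * P') := by ring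
      _ ≤ c * Real.exp (-(N * P)) * wordSum N fun l => w l ^ (q + t) := by
          gcongr
          exact (hZ N).1
      _ ≤ _ := by
          rw [← hs]
          exact wordSum_le_wordSum fun l _ =>
            mul_le_mul_of_nonneg_right (hlo l) (Real.rpow_nonneg (hw.nonneg l) t)
  · calc _ ≤ C * Real.exp (-(N * P)) * wordSum N fun l => w l ^ (q + t) := by
          rw [← hs]
          exact wordSum_le_wordSum fun l _ =>
            mul_le_mul_of_nonneg_right (hhi l) (Real.rpow_nonneg (hw.nonneg l) t)
      _ ≤ C * Real.exp (-(N * P)) * (B * Real.exp (N * P')) := by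
          gcongr
          exact (hZ N).2
      _ = _ := by ring

/-- There is a number dominating all subgradients of the pressure on the right and dominated by
all subgradients on the left. -/
theorem exists_slope (hw : Weight w) (hq : 0 < q) (hμ : IsGibbs (fun l => w l ^ q) μ) :
    ∃ lam : ℝ, ∀ s : ℝ,
      ((∀ t, 0 < t → s * t ≤ Weight.press (fun l => w l ^ (q + t)) -
        Weight.press (fun l => w l ^ q)) → s ≤ lam) ∧
      ((∀ t, -q < t → t < 0 → s * t ≤ Weight.press (fun l => w l ^ (q + t)) -
        Weight.press (fun l => w l ^ q)) → lam ≤ s) := by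
  have := hμ.prob
  obtain ⟨c, hc, hmom⟩ := hμ.exists_moment_bounds hw hq
  obtain ⟨lam, D, hlamD, hXD, hconv⟩ := hμ.exists_exponent hw hq
  have hpos := hμ.ae_pos hw hq
  -- The exponent `t = K / N` keeps `N * t` fixed, so the moment becomes the integral of `exp (K *
  -- Y)` with `Y` close to `lam` in `L¹`.
  have core : ∀ K s : ℝ, (∀ᶠ N : ℕ in atTop, s * (K / N) ≤
      Weight.press (fun l => w l ^ (q + K / N)) - Weight.press (fun l => w l ^ q)) →
      c * Real.exp (K * s) ≤ Real.exp (K * lam) := by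
    intro K s hev
    have hev2 : ∀ᶠ N : ℕ in atTop, 0 < q + K / N := by
      have : Tendsto (fun N : ℕ => q + K / N) atTop (𝓝 (q + 0)) :=
        tendsto_const_nhds.add (tendsto_const_div_atTop_nhds_zero_nat K)
      rw [add_zero] at this
      exact this.eventually (lt_mem_nhds hq)
    obtain ⟨N₀, hN₀⟩ := eventually_atTop.1 (hev.and hev2)
    refine le_of_forall_pos_le_add fun ε hε => ?_
    set G := Real.exp (|K| * D) * |K| with hG
    have hG0 : 0 ≤ G := by positivity
    obtain ⟨N, hN, hN0, hE⟩ := hconv (ε / (G + 1)) (by positivity) N₀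
    obtain ⟨h1, h2⟩ := hN₀ N hN
    have hNr : (0 : ℝ) < N := by exact_mod_cast hN0
    obtain ⟨_, _, hb⟩ := hmom _ h2
    have hb1 := (hb N).1
    have h3 : c * Real.exp (K * s) ≤ ∫ x, w (pre x N) ^ (K / N) ∂μ := by
      refine le_trans (mul_le_mul_of_nonneg_left (Real.exp_le_exp.2 ?_) hc.le) hb1
      calc K * s = N * (s * (K / N)) := by field_simp
        _ ≤ _ := by gcongr
    have hi2 : Integrable (fun x => |Real.log (w (pre x N)) / N - lam|) μ :=
      integrable_comp_pre μ (fun l => |Real.log (w l) / N - lam|) N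
    have h4 : ∫ x, w (pre x N) ^ (K / N) ∂μ ≤
        ∫ x, (Real.exp (K * lam) + G * |Real.log (w (pre x N)) / N - lam|) ∂μ := by
      refine integral_mono_ae (integrable_comp_pre μ (fun l => w l ^ (K / N)) N)
        ((integrable_const _).add (hi2.const_mul _)) ?_
      filter_upwards [hpos] with x hx
      set Y := Real.log (w (pre x N)) / N with hY
      have e1 : w (pre x N) ^ (K / N) = Real.exp (K * Y) := by
        rw [Real.rpow_def_of_pos (hx N), hY]
        congr 1
        ring
      rw [e1]
      -- The tangent inequality for `exp` at `K * Y`; with the uniform bound on `Y` it bounds the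
      -- error linearly in `|Y - lam|`.
      have e2 : Real.exp (K * Y) * (1 + (K * lam - K * Y)) ≤ Real.exp (K * lam) := by
        have h5 := Real.add_one_le_exp (K * lam - K * Y)
        have h6 : Real.exp (K * lam) = Real.exp (K * Y) * Real.exp (K * lam - K * Y) := by
          rw [← Real.exp_add]; ring_nf
        rw [h6]
        gcongr
        linarith
      have e3 : Real.exp (K * Y) ≤ Real.exp (|K| * D) := by
        apply Real.exp_le_exp.2
        calc K * Y ≤ |K * Y| := le_abs_self _
          _ = |K| * |Y| := abs_mul _ _
          _ ≤ _ := by gcongr; exact hXD N x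
      have e4 : Real.exp (K * Y) * (K * Y - K * lam) ≤ G * |Y - lam| := by
        calc _ ≤ Real.exp (K * Y) * |K * Y - K * lam| := by
              gcongr; exact le_abs_self _
          _ = Real.exp (K * Y) * (|K| * |Y - lam|) := by rw [← mul_sub, abs_mul]
          _ ≤ Real.exp (|K| * D) * (|K| * |Y - lam|) := by gcongr
          _ = _ := by rw [hG]; ring
      nlinarith
    rw [integral_add (integrable_const _) (hi2.const_mul _), integral_const_mul] at h4
    simp only [integral_const, probReal_univ, smul_eq_mul, one_mul] at h4
    have h5 : G * (ε / (G + 1)) ≤ ε := by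
      rw [mul_div_assoc', div_le_iff₀ (by positivity)]
      nlinarith
    have h6 : G * ∫ x, |Real.log (w (pre x N)) / N - lam| ∂μ ≤ G * (ε / (G + 1)) := by gcongr
    linarith
  have core' : ∀ K s : ℝ, (∀ᶠ N : ℕ in atTop, s * (K / N) ≤
      Weight.press (fun l => w l ^ (q + K / N)) - Weight.press (fun l => w l ^ q)) →
      K * (s - lam) ≤ -Real.log c := by
    intro K s h
    have h1 := core K s h
    rw [← Real.exp_log hc, ← Real.exp_add, Real.exp_le_exp] at h1
    linarith
  -- The product `K * (s - lam)` is bounded above independently of `K`: large positive `K` excludes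
  -- `s > lam`, large negative `K` excludes `s < lam`.
  refine ⟨lam, fun s => ⟨fun h => ?_, fun h => ?_⟩⟩
  · by_contra! hlt
    obtain ⟨k, hk⟩ := exists_nat_gt (-Real.log c / (s - lam))
    rw [div_lt_iff₀ (by linarith)] at hk
    have h1 := core' (k + 1) s ?_
    · nlinarith
    · filter_upwards [eventually_gt_atTop 0] with N hN
      exact h _ (by positivity)
  · by_contra! hlt
    obtain ⟨k, hk⟩ := exists_nat_gt (-Real.log c / (lam - s))
    rw [div_lt_iff₀ (by linarith)] at hk
    have h1 := core' (-(k + 1)) s ?_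
    · nlinarith
    · have : Tendsto (fun N : ℕ => (-((k : ℝ) + 1)) / N) atTop (𝓝 0) :=
        tendsto_const_div_atTop_nhds_zero_nat _
      filter_upwards [this.eventually (lt_mem_nhds (neg_lt_zero.2 hq)),
        eventually_gt_atTop 0] with N hN1 hN2
      refine h _ hN1 (div_neg_of_neg_of_pos ?_ (by exact_mod_cast hN2))
      linarith [k.cast_nonneg (α := ℝ)]

end IsGibbs

/-! ### Convexity and differentiability of the pressure -/

namespace Weight

variable {m : ℕ} {w : List (Fin m) → ℝ}

/-- Hölder's inequality with exponents `1 / a` and `1 / b` for each word length, then the limit. -/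
theorem convexOn_press (hw : Weight w) :
    ConvexOn ℝ (Set.Ioi 0) fun q : ℝ => press fun l => w l ^ q := by
  refine convexOn_iff_forall_pos.2 ⟨convex_Ioi 0, fun p hp q hq a b ha hb hab => ?_⟩
  simp only [Set.mem_Ioi, smul_eq_mul] at *
  have hs : 0 < a * p + b * q := by positivity
  have tp := ((hw.rpow hp).tendsto_press.const_mul a).add ((hw.rpow hq).tendsto_press.const_mul b)
  refine le_of_tendsto_of_tendsto' (hw.rpow hs).tendsto_press tp fun n => ?_
  have zp := (hw.rpow hp).wordSum_pos n
  have zq := (hw.rpow hq).wordSum_pos n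
  have zs := (hw.rpow hs).wordSum_pos n
  have hconj : (1 / a).HolderConjugate (1 / b) := by
    rw [Real.holderConjugate_iff]
    refine ⟨?_, by simpa using hab⟩
    rw [lt_div_iff₀ ha]
    linarith
  have hol := Real.inner_le_Lp_mul_Lq_of_nonneg (Finset.univ : Finset (Fin n → Fin m))
    (f := fun J => w (List.ofFn J) ^ (a * p)) (g := fun J => w (List.ofFn J) ^ (b * q)) hconj
    (fun J _ => Real.rpow_nonneg (hw.nonneg _) _) (fun J _ => Real.rpow_nonneg (hw.nonneg _) _)
  have key : wordSum n (fun l => w l ^ (a * p + b * q)) ≤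
      wordSum n (fun l => w l ^ p) ^ a * wordSum n (fun l => w l ^ q) ^ b := by
    have e1 : ∀ J : Fin n → Fin m, w (List.ofFn J) ^ (a * p) * w (List.ofFn J) ^ (b * q) =
        w (List.ofFn J) ^ (a * p + b * q) := by
      intro J
      rw [Real.rpow_add_of_nonneg (hw.nonneg _) (by positivity) (by positivity)]
    have e2 : ∀ J : Fin n → Fin m, (w (List.ofFn J) ^ (a * p)) ^ (1 / a) =
        w (List.ofFn J) ^ p := by
      intro J
      rw [← Real.rpow_mul (hw.nonneg _)]
      congr 1
      field_simp
    have e3 : ∀ J : Fin n → Fin m, (w (List.ofFn J) ^ (b * q)) ^ (1 / b) =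
        w (List.ofFn J) ^ q := by
      intro J
      rw [← Real.rpow_mul (hw.nonneg _)]
      congr 1
      field_simp
    simp only [e1, e2, e3, one_div_one_div] at hol
    exact hol
  have hlog := Real.log_le_log zs key
  rw [Real.log_mul (Real.rpow_pos_of_pos zp a).ne' (Real.rpow_pos_of_pos zq b).ne',
    Real.log_rpow zp, Real.log_rpow zq] at hlog
  rw [mul_div_assoc', mul_div_assoc', ← add_div]
  gcongr

/-- The one-sided derivatives are subgradients, so `exists_slope` puts the right one below `lam` and
the left one above; convexity gives the opposite order. -/
theorem differentiableAt_press (hw : Weight w) {q : ℝ} (hq : 0 < q) :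
    DifferentiableAt ℝ (fun q : ℝ => press fun l => w l ^ q) q := by
  obtain ⟨μ, hμ⟩ := (hw.rpow hq).exists_isGibbs
  obtain ⟨lam, hlam⟩ := hμ.exists_slope hw hq
  have hconv := hw.convexOn_press
  set p := fun q : ℝ => press fun l => w l ^ q with hp
  have hint : q ∈ interior (Set.Ioi (0 : ℝ)) := by rwa [interior_Ioi]
  set b := derivWithin p (Set.Ioi q) q
  set a := derivWithin p (Set.Iio q) q
  have hb : b ≤ lam := by
    refine (hlam b).1 fun t ht => ?_
    have h := hconv.rightDeriv_le_slope_of_mem_interior hint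
      (show q + t ∈ Set.Ioi (0 : ℝ) from by simp only [Set.mem_Ioi]; linarith) (by linarith)
    rw [slope_def_field, add_sub_cancel_left, le_div_iff₀ ht] at h
    exact h
  have ha : lam ≤ a := by
    refine (hlam a).2 fun t ht1 ht2 => ?_
    have h := hconv.slope_le_leftDeriv_of_mem_interior
      (show q + t ∈ Set.Ioi (0 : ℝ) from by simp only [Set.mem_Ioi]; linarith) hint (by linarith)
    rw [slope_def_field, sub_add_cancel_left, div_le_iff₀ (by linarith)] at h
    change a * t ≤ p (q + t) - p q
    linarith
  have hab : a = b :=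
    le_antisymm (hconv.leftDeriv_le_rightDeriv_of_mem_interior hint) (hb.trans ha)
  have hr := hconv.hasDerivWithinAt_rightDeriv_of_mem_interior hint
  have hl := hconv.hasDerivWithinAt_leftDeriv_of_mem_interior hint
  change HasDerivWithinAt p b (Set.Ioi q) q at hr
  change HasDerivWithinAt p a (Set.Iio q) q at hl
  rw [hab] at hl
  have h : HasDerivAt p b q := by
    rw [hasDerivAt_iff_tendsto_slope_left_right]
    exact ⟨(hasDerivWithinAt_iff_tendsto_slope' (by simp)).1 hl,
      (hasDerivWithinAt_iff_tendsto_slope' (by simp)).1 hr⟩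
  exact h.differentiableAt

end Weight

/-! ### Growth rate along almost every sequence -/

/-- The sequences along which the weight grows exponentially at rate exactly `α`. -/
def growthSet {m : ℕ} (w : List (Fin m) → ℝ) (α : ℝ) : Set (ℕ → Fin m) :=
  {x | (∀ n, 0 < w (pre x n)) ∧
    Tendsto (fun n : ℕ => Real.log (w (pre x n)) / (n : ℝ)) atTop (𝓝 α)}

namespace IsGibbs

variable {m : ℕ} {w : List (Fin m) → ℝ} {q : ℝ} {μ : Measure (ℕ → Fin m)}

/-- Markov's inequality for the `t`-th moment gives exponentially small probabilities, and
Borel–Cantelli applies. Keeping the factor `t` treats upper deviations (`t > 0`) and lower ones (`t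
< 0`) at once. -/
theorem ae_eventually_mul_log_lt (hw : Weight w) (hq : 0 < q)
    (hμ : IsGibbs (fun l => w l ^ q) μ) {t β : ℝ} (ht : 0 < q + t)
    (hβ : Weight.press (fun l => w l ^ (q + t)) - Weight.press (fun l => w l ^ q) < t * β) :
    ∀ᵐ x ∂μ, ∀ᶠ n : ℕ in atTop, t * Real.log (w (pre x n)) < t * β * n := by
  have := hμ.prob
  obtain ⟨_, _, hmom⟩ := hμ.exists_moment_bounds hw hq
  obtain ⟨C, hC, hb⟩ := hmom t ht
  set φ := Weight.press (fun l => w l ^ (q + t)) - Weight.press (fun l => w l ^ q)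
  set δ := t * β - φ with hδ
  have hδ0 : 0 < δ := by linarith
  set s : ℕ → Set (ℕ → Fin m) := fun n => {x | Real.exp (t * β * n) ≤ w (pre x n) ^ t}
  have hs : ∀ n : ℕ, μ (s n) ≤ ENNReal.ofReal (C * Real.exp (-δ) ^ n) := by
    intro n
    have h1 := mul_meas_ge_le_integral_of_nonneg (μ := μ) (f := fun x => w (pre x n) ^ t)
      (Eventually.of_forall fun x => Real.rpow_nonneg (hw.nonneg _) t)
      (integrable_comp_pre μ (fun l => w l ^ t) n) (Real.exp (t * β * n))
    have h2 := h1.trans (hb n).2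
    rw [← ofReal_measureReal (measure_ne_top _ _)]
    refine ENNReal.ofReal_le_ofReal ?_
    rw [← Real.exp_nat_mul]
    have h3 : C * Real.exp (n * -δ) * Real.exp (t * β * n) = C * Real.exp (n * φ) := by
      rw [mul_assoc, ← Real.exp_add, hδ]
      ring_nf
    rw [← h3, mul_comm (Real.exp _)] at h2
    exact le_of_mul_le_mul_right h2 (Real.exp_pos _)
  have hsum : ∑' n, μ (s n) ≠ ⊤ := by
    refine ne_top_of_le_ne_top ?_ (ENNReal.tsum_le_tsum hs)
    refine Summable.tsum_ofReal_ne_top ?_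
    refine (summable_geometric_of_lt_one (Real.exp_pos _).le ?_).mul_left C
    rw [Real.exp_lt_one_iff]
    linarith
  filter_upwards [ae_eventually_notMem hsum, hμ.ae_pos hw hq] with x hx hpos
  filter_upwards [hx] with n hn
  have h1 : w (pre x n) ^ t < Real.exp (t * β * n) := not_le.1 hn
  rw [Real.rpow_def_of_pos (hpos n), Real.exp_lt_exp] at h1
  linarith

theorem ae_mem_growthSet (hw : Weight w) (hq : 0 < q) (hμ : IsGibbs (fun l => w l ^ q) μ) {α : ℝ}
    (hα : HasDerivAt (fun q : ℝ => Weight.press fun l => w l ^ q) α q) :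
    ∀ᵐ x ∂μ, x ∈ growthSet w α := by
  set p := fun q : ℝ => Weight.press fun l => w l ^ q with hp
  rw [hasDerivAt_iff_tendsto_slope_left_right] at hα
  have hup : ∀ ε : ℝ, 0 < ε → ∀ᵐ x ∂μ, ∀ᶠ n : ℕ in atTop,
      Real.log (w (pre x n)) / n < α + ε := by
    intro ε hε
    obtain ⟨y, hy1, hy2⟩ := ((hα.2.eventually (gt_mem_nhds (show α < α + ε by linarith))).and
      self_mem_nhdsWithin).exists
    have ht : 0 < y - q := sub_pos.2 hy2
    rw [slope_def_field, div_lt_iff₀ ht] at hy1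
    have h := hμ.ae_eventually_mul_log_lt hw hq (t := y - q) (β := α + ε) (by linarith)
      (by rw [add_sub_cancel, mul_comm]; exact hy1)
    filter_upwards [h] with x hx
    filter_upwards [hx, eventually_gt_atTop 0] with n hn hn0
    have hn0' : (0 : ℝ) < n := by exact_mod_cast hn0
    rw [div_lt_iff₀ hn0']
    rw [mul_assoc] at hn
    exact lt_of_mul_lt_mul_left hn ht.le
  have hlow : ∀ ε : ℝ, 0 < ε → ∀ᵐ x ∂μ, ∀ᶠ n : ℕ in atTop,
      α - ε < Real.log (w (pre x n)) / n := by
    intro ε hε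
    obtain ⟨y, ⟨hy1, hy2⟩, hy0⟩ := (((hα.1.eventually
      (lt_mem_nhds (show α - ε < α by linarith))).and self_mem_nhdsWithin).and
      (nhdsWithin_le_nhds (lt_mem_nhds hq))).exists
    have ht : y - q < 0 := sub_neg.2 hy2
    rw [slope_def_field, lt_div_iff_of_neg ht] at hy1
    have h := hμ.ae_eventually_mul_log_lt hw hq (t := y - q) (β := α - ε) (by linarith)
      (by rw [add_sub_cancel, mul_comm]; exact hy1)
    filter_upwards [h] with x hx
    filter_upwards [hx, eventually_gt_atTop 0] with n hn hn0
    have hn0' : (0 : ℝ) < n := by exact_mod_cast hn0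
    rw [lt_div_iff₀ hn0']
    rw [mul_assoc] at hn
    exact (mul_lt_mul_left_of_neg ht).1 hn
  have hup' := ae_all_iff.2 fun k : ℕ => hup (1 / ((k : ℝ) + 1)) (by positivity)
  have hlow' := ae_all_iff.2 fun k : ℕ => hlow (1 / ((k : ℝ) + 1)) (by positivity)
  filter_upwards [hμ.ae_pos hw hq, hup', hlow'] with x hx h1 h2
  refine ⟨hx, Metric.tendsto_nhds.2 fun ε hε => ?_⟩
  obtain ⟨k, hk⟩ := exists_nat_one_div_lt hε
  filter_upwards [h1 k, h2 k] with n hn1 hn2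
  rw [Real.dist_eq, abs_lt]
  constructor <;> linarith

/-- A cylinder has mass at most one. This makes the claimed dimension nonnegative. -/
theorem mul_le_press (hμ : IsGibbs (fun l => w l ^ q) μ) {α : ℝ}
    {x : ℕ → Fin m} (hx : x ∈ growthSet w α) : α * q ≤ Weight.press fun l => w l ^ q := by
  have := hμ.prob
  obtain ⟨c, hc, hlo⟩ := hμ.lower
  set P := Weight.press fun l => w l ^ q
  have h1 : Tendsto (fun n : ℕ => Real.log (w (pre x n)) / n * q + Real.log c / n) atTop
      (𝓝 (α * q + 0)) :=
    (hx.2.mul_const q).add (tendsto_const_div_atTop_nhds_zero_nat _)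
  rw [add_zero] at h1
  refine le_of_tendsto h1 ?_
  filter_upwards [eventually_gt_atTop 0] with n hn
  have hn' : (0 : ℝ) < n := by exact_mod_cast hn
  have h2 := (hlo (pre x n)).trans measureReal_le_one
  have hpos := hx.1 n
  have h3 := Real.log_nonpos (by positivity) h2
  rw [Real.log_mul hc.ne' (by positivity), Real.log_mul (by positivity) (by positivity),
    Real.log_exp, Real.log_rpow hpos, length_pre] at h3
  rw [div_mul_eq_mul_div, ← add_div, div_le_iff₀ hn']
  linarith

end IsGibbs

/-! ### Hausdorff dimension of the growth sets -/

section Metric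

variable {m : ℕ}

/-- A sequence of symbols as a point of the metric space `FullShift m`. -/
def toFullShift (x : ℕ → Fin m) : FullShift m := x

theorem dist_toFullShift_of_ne {x y : ℕ → Fin m} (h : x ≠ y) :
    dist (toFullShift x) (toFullShift y) =
      ((m : ℝ) ^ (PiNat.firstDiff (E := fun _ => Fin m) x y + 1))⁻¹ :=
  if_neg h

theorem pre_eq_pre_iff_le_firstDiff {x y : ℕ → Fin m} (h : x ≠ y) {n : ℕ} :
    pre x n = pre y n ↔ n ≤ PiNat.firstDiff (E := fun _ => Fin m) x y := by
  rw [pre_eq_pre_iff]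
  exact PiNat.mem_cylinder_iff_le_firstDiff (E := fun _ => Fin m) h n

theorem one_le_cast_of_seq (x : ℕ → Fin m) : (1 : ℝ) ≤ m := one_le_of_point (m := m) x

theorem dist_toFullShift_le {x y : ℕ → Fin m} {n : ℕ} (h : pre x n = pre y n) :
    dist (toFullShift x) (toFullShift y) ≤ ((m : ℝ) ^ n)⁻¹ := by
  have h1 := one_le_cast_of_seq x
  by_cases hxy : x = y
  · rw [hxy, dist_self]
    positivity
  · rw [dist_toFullShift_of_ne hxy]
    rw [pre_eq_pre_iff_le_firstDiff hxy] at h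
    apply inv_anti₀ (by positivity)
    exact pow_le_pow_right₀ h1 (by omega)

theorem continuous_toFullShift (hm : 2 ≤ m) : Continuous (toFullShift (m := m)) := by
  have hm' : (1 : ℝ) < m := by exact_mod_cast hm
  rw [continuous_iff_continuousAt]
  intro x
  rw [ContinuousAt, Metric.tendsto_nhds]
  intro ε hε
  obtain ⟨n, hn⟩ := exists_pow_lt_of_lt_one hε (inv_lt_one_of_one_lt₀ hm')
  filter_upwards [(isClopen_cyl (pre x n)).isOpen.mem_nhds (mem_cyl_pre x n)] with y hy
  rw [mem_cyl, length_pre] at hy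
  refine (dist_toFullShift_le hy).trans_lt ?_
  rwa [← inv_pow]

/-- The metric of `FullShift m` induces the product topology. -/
def fullShiftHomeomorph (hm : 2 ≤ m) : (ℕ → Fin m) ≃ₜ FullShift m :=
  Continuous.homeoOfEquivCompactToT2 (f := ⟨toFullShift, fun x => x, fun _ => rfl, fun _ => rfl⟩)
    (continuous_toFullShift hm)

/-- Choose `β < α` with `-β q + P` still at most `s log m`. Sequences whose weight stays above `exp
(n β)` from length `k` on are covered by the cylinders of that weight, and the covering sums stay
bounded. -/
theorem dimH_growthSet_le (hm : 2 ≤ m) {w : List (Fin m) → ℝ} (hw : Weight w) {q : ℝ} (hq : 0 < q)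
    {α : ℝ} {s : NNReal} (hs0 : 0 < s)
    (hs : -α * q + Weight.press (fun l => w l ^ q) < s * Real.log m) :
    dimH (toFullShift '' growthSet w α) ≤ s := by
  classical
  borelize (FullShift m)
  have hm0 : (0 : ℝ) < m := by exact_mod_cast (by omega : 0 < m)
  obtain ⟨C, hC, hZ⟩ := (hw.rpow hq).exists_wordSum_bounds
  set P := Weight.press (fun l => w l ^ q)
  obtain ⟨β, hβ1, hβ2⟩ : ∃ β, β < α ∧ -β * q + P ≤ s * Real.log m := by
    refine ⟨α - (s * Real.log m - (-α * q + P)) / q, ?_, ?_⟩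
    · have : 0 < (s * Real.log m - (-α * q + P)) / q := div_pos (by linarith) hq
      linarith
    · rw [neg_sub, sub_mul, div_mul_cancel₀ _ hq.ne']
      linarith
  set G : ℕ → Set (ℕ → Fin m) := fun k =>
    {x | ∀ n ≥ k, Real.exp (n * β) ≤ w (pre x n)} with hG
  have hcover : growthSet w α ⊆ ⋃ k, G k := by
    intro x hx
    have h := (hx.2.eventually (lt_mem_nhds hβ1)).and (eventually_gt_atTop 0)
    obtain ⟨k, hk⟩ := eventually_atTop.1 h
    refine Set.mem_iUnion.2 ⟨k, fun n hn => ?_⟩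
    obtain ⟨h1, h2⟩ := hk n hn
    rw [lt_div_iff₀ (by exact_mod_cast h2)] at h1
    rw [← Real.le_log_iff_exp_le (hx.1 n)]
    linarith
  have hdim : ∀ k, dimH (toFullShift '' G k) ≤ s := by
    intro k
    refine dimH_le_of_hausdorffMeasure_ne_top (ne_top_of_le_ne_top ENNReal.ofReal_ne_top
      (b := ENNReal.ofReal C) ?_)
    have hr : Tendsto (fun n : ℕ => ENNReal.ofReal ((m : ℝ) ^ n)⁻¹) atTop (𝓝 0) := by
      rw [← ENNReal.ofReal_zero]
      refine ENNReal.tendsto_ofReal ?_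
      simp only [← inv_pow]
      exact tendsto_pow_atTop_nhds_zero_of_lt_one (by positivity)
        (inv_lt_one_of_one_lt₀ (by exact_mod_cast hm))
    set t : ∀ n : ℕ, (Fin n → Fin m) → Set (FullShift m) := fun n J =>
      if Real.exp (n * β) ≤ w (List.ofFn J) then toFullShift '' cyl (List.ofFn J) else ∅ with ht
    have hdiam : ∀ (n : ℕ) (J : Fin n → Fin m),
        Metric.ediam (t n J) ≤ ENNReal.ofReal ((m : ℝ) ^ n)⁻¹ := by
      intro n J
      simp only [ht]
      split_ifs
      · refine Metric.ediam_le ?_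
        rintro _ ⟨x, hx, rfl⟩ _ ⟨y, hy, rfl⟩
        rw [edist_dist]
        refine ENNReal.ofReal_le_ofReal (dist_toFullShift_le ?_)
        rw [mem_cyl, List.length_ofFn] at hx hy
        rw [hx, hy]
      · simp
    have hle := Measure.hausdorffMeasure_le_liminf_sum (s : ℝ) (toFullShift '' G k) _ hr t
      (Eventually.of_forall hdiam) (by
        filter_upwards [eventually_ge_atTop k] with n hn
        rintro _ ⟨x, hx, rfl⟩
        refine Set.mem_iUnion.2 ⟨fun j : Fin n => x j, ?_⟩
        have h1 : Real.exp (n * β) ≤ w (List.ofFn fun j : Fin n => x j) := hx n hn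
        simp only [ht, h1, if_true]
        exact ⟨x, mem_cyl_pre x n, rfl⟩)
    refine hle.trans (liminf_le_of_le (by isBoundedDefault) fun b hb => ?_)
    obtain ⟨n, hn⟩ := hb.exists
    refine hn.trans ?_
    -- A selected cylinder has `exp (-n β q) w ^ q ≥ 1`, so this factor can be inserted; a rejected
    -- one is `∅` and contributes `0` because `s > 0`.
    have hterm : ∀ J : Fin n → Fin m, Metric.ediam (t n J) ^ (s : ℝ) ≤
        ENNReal.ofReal (Real.exp (-(n * (s * Real.log m))) *
          (Real.exp (-(n * (β * q))) * w (List.ofFn J) ^ q)) := by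
      intro J
      by_cases hJ : Real.exp (n * β) ≤ w (List.ofFn J)
      · refine (ENNReal.rpow_le_rpow (hdiam n J) s.coe_nonneg).trans ?_
        rw [ENNReal.ofReal_rpow_of_pos (by positivity)]
        refine ENNReal.ofReal_le_ofReal ?_
        have e1 : (((m : ℝ) ^ n)⁻¹) ^ (s : ℝ) = Real.exp (-(n * (s * Real.log m))) := by
          rw [Real.rpow_def_of_pos (by positivity), Real.log_inv, Real.log_pow]
          ring_nf
        have e2 : 1 ≤ Real.exp (-(n * (β * q))) * w (List.ofFn J) ^ q := by
          have h1 := Real.rpow_le_rpow (Real.exp_pos _).le hJ hq.le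
          rw [← Real.exp_mul] at h1
          calc (1 : ℝ) = Real.exp (-(n * (β * q))) * Real.exp (n * β * q) := by
                rw [← Real.exp_add, ← mul_assoc, neg_add_cancel, Real.exp_zero]
            _ ≤ _ := by gcongr
        rw [e1]
        exact le_mul_of_one_le_right (Real.exp_pos _).le e2
      · have : t n J = ∅ := if_neg hJ
        rw [this, Metric.ediam_empty, ENNReal.zero_rpow_of_pos (by exact_mod_cast hs0)]
        exact zero_le
    refine (Finset.sum_le_sum fun J _ => hterm J).trans ?_
    rw [← ENNReal.ofReal_sum_of_nonneg fun J _ =>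
      mul_nonneg (Real.exp_pos _).le (mul_nonneg (Real.exp_pos _).le
        (Real.rpow_nonneg (hw.nonneg _) q))]
    refine ENNReal.ofReal_le_ofReal ?_
    rw [← Finset.mul_sum, ← Finset.mul_sum]
    calc Real.exp (-(n * (s * Real.log m))) *
          (Real.exp (-(n * (β * q))) * wordSum n fun l => w l ^ q)
        ≤ Real.exp (-(n * (s * Real.log m))) *
          (Real.exp (-(n * (β * q))) * (C * Real.exp (n * P))) := by
          gcongr
          exact (hZ n).2
      _ = C * Real.exp (n * (-β * q + P - s * Real.log m)) := by
          have : (n : ℝ) * (-β * q + P - s * Real.log m) =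
            -(n * (s * Real.log m)) + (-(n * (β * q)) + n * P) := by ring
          rw [this, Real.exp_add, Real.exp_add]
          ring
      _ ≤ C * 1 := by
          gcongr
          rw [Real.exp_le_one_iff]
          exact mul_nonpos_of_nonneg_of_nonpos (Nat.cast_nonneg n) (by linarith)
      _ = C := mul_one C
  refine (dimH_mono (Set.image_mono hcover)).trans ?_
  rw [Set.image_iUnion, dimH_iUnion]
  exact iSup_le hdim

/-- Fix `x` in both sets and let `n` be the least index at which a point of `S` leaves `x`. Then `S`
lies in the cylinder of order `n` around `x` and has diameter at least `m ^ (-(n + 1))`. If `S`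
contains only `x`, the bound on shrinking cylinders shows that `x` has mass zero. -/
theorem measure_le_ediam_rpow (hm : 2 ≤ m) (μ : Measure (ℕ → Fin m)) {s : ℝ} (hs : 0 < s) (k : ℕ)
    {F : Set (ℕ → Fin m)}
    (hF : ∀ x ∈ F, ∀ n ≥ k, μ (cyl (pre x n)) ≤ ENNReal.ofReal (((m : ℝ) ^ (n + 1))⁻¹) ^ s)
    {S : Set (FullShift m)} (hS : Metric.ediam S ≤ ENNReal.ofReal (((m : ℝ) ^ (k + 1))⁻¹)) :
    μ (toFullShift ⁻¹' S ∩ F) ≤ Metric.ediam S ^ s := by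
  have hm1 : (1 : ℝ) < m := by exact_mod_cast hm
  have hm0 : (0 : ℝ) < m := by linarith
  rcases (toFullShift ⁻¹' S ∩ F).eq_empty_or_nonempty with h | ⟨x, hxS, hxF⟩
  · rw [h, measure_empty]
    exact zero_le
  refine (measure_mono Set.inter_subset_left).trans ?_
  by_cases hsub : ∀ y, toFullShift y ∈ S → y = x
  · have h0 : μ (toFullShift ⁻¹' S) ≤ 0 := by
      have hlim : Tendsto (fun n : ℕ => ENNReal.ofReal (((m : ℝ) ^ (n + 1))⁻¹) ^ s) atTop (𝓝 0) := by
        rw [← ENNReal.zero_rpow_of_pos hs]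
        refine (ENNReal.continuous_rpow_const.tendsto 0).comp ?_
        rw [← ENNReal.ofReal_zero]
        refine ENNReal.tendsto_ofReal ?_
        simp only [← inv_pow]
        exact (tendsto_pow_atTop_nhds_zero_of_lt_one (by positivity)
          (inv_lt_one_of_one_lt₀ hm1)).comp (tendsto_add_atTop_nat 1)
      refine ge_of_tendsto hlim ?_
      filter_upwards [eventually_ge_atTop k] with n hn
      refine le_trans (measure_mono ?_) (hF x hxF n hn)
      intro y hy
      rw [hsub y hy]
      exact mem_cyl_pre x n
    exact h0.trans zero_le
  · push Not at hsub
    classical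
    have hex : ∃ n, ∃ y, toFullShift y ∈ S ∧ y ≠ x ∧
        PiNat.firstDiff (E := fun _ => Fin m) x y = n := by
      obtain ⟨y, hy1, hy2⟩ := hsub
      exact ⟨_, y, hy1, hy2, rfl⟩
    obtain ⟨y, hyS, hyx, hyn⟩ := Nat.find_spec hex
    set n := Nat.find hex with hn
    have hed : ENNReal.ofReal (((m : ℝ) ^ (n + 1))⁻¹) ≤ Metric.ediam S := by
      rw [← hyn, ← dist_toFullShift_of_ne hyx.symm, ← edist_dist]
      exact Metric.edist_le_ediam_of_mem hxS hyS
    have hkn : k ≤ n := by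
      have h1 := hed.trans hS
      rw [ENNReal.ofReal_le_ofReal_iff (by positivity), inv_le_inv₀ (by positivity)
        (by positivity), pow_le_pow_iff_right₀ hm1] at h1
      omega
    calc μ (toFullShift ⁻¹' S) ≤ μ (cyl (pre x n)) := by
          refine measure_mono fun z hz => ?_
          by_cases hzx : z = x
          · rw [hzx]
            exact mem_cyl_pre x n
          · rw [mem_cyl, length_pre, eq_comm,
              pre_eq_pre_iff_le_firstDiff (fun h => hzx h.symm)]
            exact Nat.find_min' hex ⟨z, hz, hzx, rfl⟩
      _ ≤ ENNReal.ofReal (((m : ℝ) ^ (n + 1))⁻¹) ^ s := hF x hxF n hkn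
      _ ≤ _ := ENNReal.rpow_le_rpow hed hs.le

theorem le_dimH_growthSet (hm : 2 ≤ m) {w : List (Fin m) → ℝ} {q : ℝ}
    {μ : Measure (ℕ → Fin m)} (hμ : IsGibbs (fun l => w l ^ q) μ) {α : ℝ}
    (hae : ∀ᵐ x ∂μ, x ∈ growthSet w α) {s : NNReal} (hs0 : 0 < s)
    (hs : s * Real.log m < -α * q + Weight.press (fun l => w l ^ q)) :
    s ≤ dimH (toFullShift '' growthSet w α) := by
  borelize (FullShift m)
  have := hμ.prob
  have hm1 : (1 : ℝ) < m := by exact_mod_cast hm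
  have hm0 : (0 : ℝ) < m := by linarith
  obtain ⟨C, hC, hhi⟩ := hμ.upper
  set P := Weight.press (fun l => w l ^ q)
  set F : ℕ → Set (ℕ → Fin m) := fun k => {x | ∀ n ≥ k,
    μ (cyl (pre x n)) ≤ ENNReal.ofReal (((m : ℝ) ^ (n + 1))⁻¹) ^ (s : ℝ)} with hF
  have hFm : ∀ k, MeasurableSet (F k) := by
    intro k
    have : F k = ⋂ n, ⋂ (_ : n ≥ k), {x : ℕ → Fin m |
        μ (cyl (pre x n)) ≤ ENNReal.ofReal (((m : ℝ) ^ (n + 1))⁻¹) ^ (s : ℝ)} := by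
      ext x
      simp [hF]
    rw [this]
    exact MeasurableSet.iInter fun n => MeasurableSet.iInter fun _ =>
      measurableSet_le (measurable_comp_pre (fun l => μ (cyl l)) n) measurable_const
  have hcover : growthSet w α ⊆ ⋃ k, F k := by
    intro x hx
    have h1 : Tendsto (fun n : ℕ => Real.log C / n + (Real.log (w (pre x n)) / n * q - P) +
        (s * Real.log m) / n) atTop (𝓝 (0 + (α * q - P) + 0)) :=
      ((tendsto_const_div_atTop_nhds_zero_nat _).add ((hx.2.mul_const q).sub_const P)).add
        (tendsto_const_div_atTop_nhds_zero_nat _)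
    have h2 := (h1.eventually (gt_mem_nhds
      (show 0 + (α * q - P) + 0 < -(s * Real.log m) by linarith))).and (eventually_gt_atTop 0)
    obtain ⟨k, hk⟩ := eventually_atTop.1 h2
    refine Set.mem_iUnion.2 ⟨k, fun n hn => ?_⟩
    obtain ⟨h3, h4⟩ := hk n hn
    have hn0 : (0 : ℝ) < n := by exact_mod_cast h4
    rw [ENNReal.ofReal_rpow_of_pos (by positivity), ← ofReal_measureReal (measure_ne_top _ _)]
    refine ENNReal.ofReal_le_ofReal ((hhi _).trans ?_)
    have hpos := hx.1 n
    rw [length_pre, ← Real.log_le_log_iff (by positivity) (by positivity),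
      Real.log_mul hC.ne' (by positivity), Real.log_mul (by positivity) (by positivity),
      Real.log_exp, Real.log_rpow hpos, Real.log_rpow (by positivity), Real.log_inv, Real.log_pow]
    have h5 := mul_lt_mul_of_pos_right h3 hn0
    have h6 : (Real.log C / n + (Real.log (w (pre x n)) / n * q - P) +
        (s * Real.log m) / n) * n = Real.log C + (Real.log (w (pre x n)) * q - n * P) +
        s * Real.log m := by
      field_simp
    rw [h6] at h5
    push_cast
    linarith
  -- On each `F k`, the measure `μ` is dominated at small scales by the `s`-th power of the
  -- diameter, hence by Hausdorff measure. A dimension below `s` would make the growth set null,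
  -- although it has full measure.
  by_contra! hlt
  have hzero : ∀ k, μ (growthSet w α ∩ F k) = 0 := by
    intro k
    have hemb := (fullShiftHomeomorph hm).measurableEmbedding
    set ν : Measure (FullShift m) := (μ.restrict (F k)).map (fullShiftHomeomorph hm)
    have hν : ∀ S, ν S = μ (toFullShift ⁻¹' S ∩ F k) := by
      intro S
      rw [hemb.map_apply, Measure.restrict_apply' (hFm k)]
      rfl
    have hle : ν ≤ Measure.hausdorffMeasure (s : ℝ) := by
      refine Measure.le_hausdorffMeasure _ _ (ENNReal.ofReal (((m : ℝ) ^ (k + 1))⁻¹))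
        (by rw [ENNReal.ofReal_pos]; positivity) fun S hS => ?_
      rw [hν]
      exact measure_le_ediam_rpow hm μ (by exact_mod_cast hs0) k (fun x hx => hx) hS
    have h0 := measure_zero_of_dimH_lt (Measure.absolutelyContinuous_of_le hle) hlt
    have himg : toFullShift ⁻¹' (toFullShift '' growthSet w α) = growthSet w α :=
      Set.preimage_image_eq _ fun _ _ h => h
    rwa [hν, himg] at h0
  have hall : μ (growthSet w α ∩ ⋃ k, F k) = 0 := by
    rw [Set.inter_iUnion]
    exact measure_iUnion_null hzero
  rw [Set.inter_eq_left.2 hcover] at hall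
  have h1 : ∀ᵐ x ∂μ, False := by
    filter_upwards [hae, measure_eq_zero_iff_ae_notMem.1 hall] with x h1 h2 using h2 h1
  exact (h1.exists).elim fun _ h => h

theorem dimH_growthSet (hm : 2 ≤ m) {w : List (Fin m) → ℝ} (hw : Weight w) {q : ℝ} (hq : 0 < q)
    {α : ℝ} (hα : HasDerivAt (fun q : ℝ => Weight.press fun l => w l ^ q) α q) :
    0 ≤ 1 / Real.log m * (-α * q + Weight.press fun l => w l ^ q) ∧
    dimH (toFullShift '' growthSet w α) =
      ENNReal.ofReal (1 / Real.log m * (-α * q + Weight.press fun l => w l ^ q)) := by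
  obtain ⟨μ, hμ⟩ := (hw.rpow hq).exists_isGibbs
  have := hμ.prob
  have hae := hμ.ae_mem_growthSet hw hq hα
  obtain ⟨x, hx⟩ := hae.exists
  have hP := hμ.mul_le_press hx
  have hlog : 0 < Real.log m := Real.log_pos (by exact_mod_cast hm)
  set E := -α * q + Weight.press fun l => w l ^ q with hE
  set v := 1 / Real.log m * E with hv
  have hE0 : 0 ≤ E := by linarith
  have hv0 : 0 ≤ v := by positivity
  have hvE : v * Real.log m = E := by rw [hv]; field_simp
  refine ⟨hv0, le_antisymm ?_ ?_⟩
  · refine ENNReal.le_of_forall_pos_le_add fun ε hε _ => ?_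
    have h := dimH_growthSet_le (s := v.toNNReal + ε) (α := α) hm hw hq (by positivity) ?_
    · rwa [ENNReal.coe_add] at h
    · rw [← hE, NNReal.coe_add, Real.coe_toNNReal v hv0, add_mul, hvE]
      have : 0 < (ε : ℝ) * Real.log m := mul_pos (by exact_mod_cast hε) hlog
      linarith
  · refine ENNReal.le_of_forall_nnreal_lt fun s hs => ?_
    rcases eq_or_ne s 0 with rfl | hs0
    · simp
    · refine le_dimH_growthSet hm hμ hae (pos_iff_ne_zero.2 hs0) ?_
      rw [← hE, ← hvE]
      have h1 : (s : ℝ) < v := by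
        rw [ENNReal.ofReal, ENNReal.coe_lt_coe] at hs
        exact Real.lt_toNNReal_iff_coe_lt.1 hs
      gcongr

end Metric

/-! ### The sum of the entries as a norm on nonnegative matrices -/

section EntrySum

variable {d : ℕ} {B C : Matrix (Fin d) (Fin d) ℝ}

theorem entrySum_nonneg (hB : ∀ s t, 0 ≤ B s t) : 0 ≤ entrySum B :=
  Finset.sum_nonneg fun s _ => Finset.sum_nonneg fun t _ => hB s t

theorem le_entrySum (hB : ∀ s t, 0 ≤ B s t) (s t : Fin d) : B s t ≤ entrySum B :=
  (Finset.single_le_sum (f := fun t => B s t) (fun t _ => hB s t) (Finset.mem_univ t)).trans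
    (Finset.single_le_sum (f := fun s => ∑ t, B s t)
      (fun s _ => Finset.sum_nonneg fun t _ => hB s t) (Finset.mem_univ s))

theorem exists_entry_pos (h : 0 < entrySum B) : ∃ s t, 0 < B s t := by
  by_contra! hle
  exact absurd h (not_lt.2 (Finset.sum_nonpos fun s _ => Finset.sum_nonpos fun t _ => hle s t))

theorem mul_nonneg_entries (hB : ∀ s t, 0 ≤ B s t) (hC : ∀ s t, 0 ≤ C s t) (s t : Fin d) :
    0 ≤ (B * C) s t := by
  rw [Matrix.mul_apply]
  exact Finset.sum_nonneg fun k _ => mul_nonneg (hB _ _) (hC _ _)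

theorem entrySum_mul (B C : Matrix (Fin d) (Fin d) ℝ) :
    entrySum (B * C) = ∑ k, (∑ s, B s k) * ∑ t, C k t := by
  simp only [entrySum, Matrix.mul_apply]
  calc _ = ∑ s, ∑ k, ∑ t, B s k * C k t :=
        Finset.sum_congr rfl fun s _ => Finset.sum_comm
    _ = _ := by
        rw [Finset.sum_comm]
        exact Finset.sum_congr rfl fun k _ => by rw [Finset.sum_mul_sum]

theorem entrySum_mul_le (hB : ∀ s t, 0 ≤ B s t) (hC : ∀ s t, 0 ≤ C s t) :
    entrySum (B * C) ≤ entrySum B * entrySum C := by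
  rw [entrySum_mul]
  have e : entrySum B = ∑ k, ∑ s, B s k := Finset.sum_comm
  rw [e, Finset.sum_mul]
  refine Finset.sum_le_sum fun k _ => mul_le_mul_of_nonneg_left ?_
    (Finset.sum_nonneg fun s _ => hB s k)
  exact Finset.single_le_sum (f := fun k => ∑ t, C k t)
    (fun k _ => Finset.sum_nonneg fun t _ => hC k t) (Finset.mem_univ k)

/-- Replacing `X` by the smaller constant matrix `c 1 1ᵗ` makes the sum of entries factor. -/
theorem mul_entrySum_le_entrySum_mul {c : ℝ} {X : Matrix (Fin d) (Fin d) ℝ}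
    (hB : ∀ s t, 0 ≤ B s t) (hC : ∀ s t, 0 ≤ C s t) (hX : ∀ s t, c ≤ X s t) :
    c * (entrySum B * entrySum C) ≤ entrySum (B * X * C) := by
  rw [Matrix.mul_assoc, entrySum_mul]
  have e : entrySum B = ∑ k, ∑ s, B s k := Finset.sum_comm
  rw [e, Finset.sum_mul, Finset.mul_sum]
  refine Finset.sum_le_sum fun k _ => ?_
  rw [mul_left_comm]
  refine mul_le_mul_of_nonneg_left ?_ (Finset.sum_nonneg fun s _ => hB s k)
  have h1 : ∑ t, (X * C) k t = ∑ l, X k l * ∑ t, C l t := by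
    simp only [Matrix.mul_apply, Finset.mul_sum]
    exact Finset.sum_comm
  rw [h1, entrySum, Finset.mul_sum]
  exact Finset.sum_le_sum fun l _ =>
    mul_le_mul_of_nonneg_right (hX k l) (Finset.sum_nonneg fun t _ => hC l t)

theorem entrySum_sum {ι : Type*} (s : Finset ι) (f : ι → Matrix (Fin d) (Fin d) ℝ) :
    entrySum (∑ i ∈ s, f i) = ∑ i ∈ s, entrySum (f i) := by
  simp only [entrySum, Matrix.sum_apply]
  calc _ = ∑ a, ∑ i ∈ s, ∑ b, f i a b := Finset.sum_congr rfl fun a _ => Finset.sum_comm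
    _ = _ := Finset.sum_comm

end EntrySum

/-! ### The weight attached to the matrix products -/

section MatrixWeight

variable {m d : ℕ}

/-- The product of the matrices along a list of letters. -/
def listProd (Mi : Fin m → Matrix (Fin d) (Fin d) ℝ) (l : List (Fin m)) :
    Matrix (Fin d) (Fin d) ℝ := (l.map Mi).prod

theorem listProd_ofFn (Mi : Fin m → Matrix (Fin d) (Fin d) ℝ) {n : ℕ} (J : Fin n → Fin m) :
    listProd Mi (List.ofFn J) = wordProd Mi J := by
  rw [listProd, wordProd, List.map_ofFn]
  rfl

theorem listProd_append (Mi : Fin m → Matrix (Fin d) (Fin d) ℝ) (I J : List (Fin m)) :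
    listProd Mi (I ++ J) = listProd Mi I * listProd Mi J := by
  simp [listProd]

theorem listProd_cons (Mi : Fin m → Matrix (Fin d) (Fin d) ℝ) (a : Fin m) (J : List (Fin m)) :
    listProd Mi (a :: J) = Mi a * listProd Mi J := by
  simp [listProd]

theorem one_entry_eq (s t : Fin d) : (1 : Matrix (Fin d) (Fin d) ℝ) s t = 0 ∨
    (1 : Matrix (Fin d) (Fin d) ℝ) s t = 1 := by
  rw [Matrix.one_apply]
  split_ifs <;> simp

theorem listProd_nonneg {Mi : Fin m → Matrix (Fin d) (Fin d) ℝ} (hMi : ∀ i s t, 0 ≤ Mi i s t)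
    (l : List (Fin m)) (s t : Fin d) : 0 ≤ listProd Mi l s t := by
  induction l generalizing s t with
  | nil =>
    change 0 ≤ (1 : Matrix (Fin d) (Fin d) ℝ) s t
    rcases one_entry_eq s t with h | h <;> rw [h]
    exact zero_le_one
  | cons a l ih =>
    rw [listProd_cons]
    exact mul_nonneg_entries (hMi a) ih s t

/-- Nonzero entries of products of nonnegative matrices decay at most exponentially. -/
theorem exists_pow_le_listProd {Mi : Fin m → Matrix (Fin d) (Fin d) ℝ}
    (hMi : ∀ i s t, 0 ≤ Mi i s t) : ∃ c : ℝ, 0 < c ∧ ∀ l s t,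
      0 < listProd Mi l s t → c ^ l.length ≤ listProd Mi l s t := by
  classical
  obtain ⟨c, hc, hle⟩ : ∃ c : ℝ, 0 < c ∧ ∀ i s t, 0 < Mi i s t → c ≤ Mi i s t := by
    -- The inserted `1` keeps the set nonempty even if no entry is positive.
    set V : Finset ℝ := insert 1 ((Finset.univ.image fun p : Fin m × Fin d × Fin d =>
      Mi p.1 p.2.1 p.2.2).filter (0 < ·))
    have hV : V.Nonempty := ⟨1, Finset.mem_insert_self _ _⟩
    refine ⟨V.min' hV, ?_, fun i s t h => V.min'_le _ ?_⟩
    · rcases Finset.mem_insert.1 (V.min'_mem hV) with h | h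
      · rw [h]
        exact one_pos
      · exact (Finset.mem_filter.1 h).2
    · exact Finset.mem_insert_of_mem (Finset.mem_filter.2
        ⟨Finset.mem_image.2 ⟨(i, s, t), Finset.mem_univ _, rfl⟩, h⟩)
  refine ⟨c, hc, fun l => ?_⟩
  induction l with
  | nil =>
    intro s t h
    change 0 < (1 : Matrix (Fin d) (Fin d) ℝ) s t at h
    change c ^ 0 ≤ (1 : Matrix (Fin d) (Fin d) ℝ) s t
    rcases one_entry_eq s t with h1 | h1
    · rw [h1] at h
      exact absurd h (lt_irrefl _)
    · rw [h1, pow_zero]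
  | cons a l ih =>
    intro s t h
    rw [listProd_cons, Matrix.mul_apply] at h ⊢
    have hn : ∀ k ∈ Finset.univ, 0 ≤ Mi a s k * listProd Mi l k t := fun k _ =>
      mul_nonneg (hMi _ _ _) (listProd_nonneg hMi _ _ _)
    obtain ⟨k, hk⟩ : ∃ k, 0 < Mi a s k * listProd Mi l k t := by
      by_contra! hle
      exact absurd h (not_lt.2 (Finset.sum_nonpos fun k _ => hle k))
    refine le_trans ?_ (Finset.single_le_sum hn (Finset.mem_univ k))
    have h1 := pos_of_mul_pos_left hk (listProd_nonneg hMi _ _ _)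
    have h2 := pos_of_mul_pos_right hk (hMi _ _ _)
    rw [List.length_cons, pow_succ']
    gcongr
    · exact hle _ _ _ h1
    · exact ih _ _ h2

variable (A : Matrix (Fin m) (Fin m) ℤ) (Mi : Fin m → Matrix (Fin d) (Fin d) ℝ)

open Classical in
/-- The norm of the matrix product along an admissible word, and zero on other words. -/
def normWeight (l : List (Fin m)) : ℝ :=
  if l.IsChain fun i j => A i j = 1 then entrySum (listProd Mi l) else 0

variable {A Mi}

theorem isChain_ofFn_iff {n : ℕ} {J : Fin n → Fin m} :
    ((List.ofFn J).IsChain fun i j => A i j = 1) ↔ Admissible A J :=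
  List.isChain_ofFn

theorem normWeight_of_isChain {l : List (Fin m)} (h : l.IsChain fun i j => A i j = 1) :
    normWeight A Mi l = entrySum (listProd Mi l) := if_pos h

theorem normWeight_of_not_isChain {l : List (Fin m)} (h : ¬ l.IsChain fun i j => A i j = 1) :
    normWeight A Mi l = 0 := if_neg h

theorem normWeight_nonneg (hMi : ∀ i s t, 0 ≤ Mi i s t) (l : List (Fin m)) :
    0 ≤ normWeight A Mi l := by
  by_cases h : l.IsChain fun i j => A i j = 1
  · rw [normWeight_of_isChain h]
    exact entrySum_nonneg (listProd_nonneg hMi l)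
  · rw [normWeight_of_not_isChain h]

theorem normWeight_append_le (hMi : ∀ i s t, 0 ≤ Mi i s t) (I J : List (Fin m)) :
    normWeight A Mi (I ++ J) ≤ normWeight A Mi I * normWeight A Mi J := by
  by_cases h : (I ++ J).IsChain fun i j => A i j = 1
  · have h' := List.isChain_append.1 h
    rw [normWeight_of_isChain h, normWeight_of_isChain h'.1, normWeight_of_isChain h'.2.1,
      listProd_append]
    exact entrySum_mul_le (listProd_nonneg hMi I) (listProd_nonneg hMi J)
  · rw [normWeight_of_not_isChain h]
    exact mul_nonneg (normWeight_nonneg hMi _) (normWeight_nonneg hMi _)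

theorem isChain_of_mem_connectingWords {k : ℕ} {i j : Fin m} {K : Fin k → Fin m}
    (hK : K ∈ connectingWords A k i j) :
    (i :: (List.ofFn K ++ [j])).IsChain fun i j => A i j = 1 := by
  classical
  unfold connectingWords at hK
  have h := (Finset.mem_filter.1 hK).2
  rw [← isChain_ofFn_iff, List.ofFn_cons, List.ofFn_succ'] at h
  simpa using h

theorem exists_le_sum_connectingWords (hm : 0 < m) (hd : 0 < d)
    {r : ℕ} (H : ∀ (i j : Fin m) (s t : Fin d),
      0 < (∑ k ∈ Finset.Icc 1 r, ∑ K ∈ connectingWords A k i j, wordProd Mi K) s t) :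
    ∃ c : ℝ, 0 < c ∧ ∀ (i j : Fin m) (s t : Fin d),
      c ≤ (∑ k ∈ Finset.Icc 1 r, ∑ K ∈ connectingWords A k i j, wordProd Mi K) s t := by
  have : Nonempty (Fin m × Fin m × Fin d × Fin d) :=
    ⟨⟨0, hm⟩, ⟨0, hm⟩, ⟨0, hd⟩, ⟨0, hd⟩⟩
  obtain ⟨p, hp⟩ := Finite.exists_min fun p : Fin m × Fin m × Fin d × Fin d =>
    (∑ k ∈ Finset.Icc 1 r, ∑ K ∈ connectingWords A k p.1 p.2.1, wordProd Mi K) p.2.2.1 p.2.2.2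
  exact ⟨_, H _ _ _ _, fun i j s t => hp (i, j, s, t)⟩

/-- By (H2), the numbers `‖M_I M_K M_J‖` over all connectors `K` add up to at least `c ‖M_I‖ ‖M_J‖`.
There are at most `T` connectors, so one of them carries a share of at least `c / T`. -/
theorem exists_connect (hm : 0 < m) (hd : 0 < d) (hMi : ∀ i s t, 0 ≤ Mi i s t)
    (H2 : IsIrreducibleFamily A Mi) :
    ∃ C : ℝ, 0 < C ∧ ∃ r : ℕ, ∀ I J, ∃ K : List (Fin m),
      K.length ≤ r ∧ normWeight A Mi I * normWeight A Mi J ≤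
        C * normWeight A Mi (I ++ K ++ J) := by
  obtain ⟨r, hr, H⟩ := H2
  obtain ⟨c, hc, hcle⟩ := exists_le_sum_connectingWords hm hd H
  set T : ℝ := ∑ k ∈ Finset.Icc 1 r, (m : ℝ) ^ k with hT
  have hm' : (0 : ℝ) < m := by exact_mod_cast hm
  have hT0 : 0 < T := Finset.sum_pos (fun k _ => by positivity) ⟨1, Finset.mem_Icc.2 ⟨le_rfl, hr⟩⟩
  refine ⟨T / c, by positivity, r, fun I J => ?_⟩
  by_cases hI : I.IsChain fun i j => A i j = 1
  swap
  · exact ⟨[], Nat.zero_le _, by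
      rw [normWeight_of_not_isChain hI, zero_mul]
      exact mul_nonneg (by positivity) (normWeight_nonneg hMi _)⟩
  by_cases hJ : J.IsChain fun i j => A i j = 1
  swap
  · exact ⟨[], Nat.zero_le _, by
      rw [normWeight_of_not_isChain hJ, mul_zero]
      exact mul_nonneg (by positivity) (normWeight_nonneg hMi _)⟩
  -- For an empty `I` or `J` any letter will do, since no junction condition arises there.
  set i : Fin m := I.getLast?.getD ⟨0, hm⟩ with hi
  set j : Fin m := J.head?.getD ⟨0, hm⟩ with hj
  have hchain : ∀ k ∈ Finset.Icc 1 r, ∀ K ∈ connectingWords A k i j,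
      (I ++ List.ofFn K ++ J).IsChain fun i j => A i j = 1 := by
    intro k hk K hK
    have h := isChain_of_mem_connectingWords hK
    rw [List.isChain_cons, List.isChain_append] at h
    obtain ⟨h1, h2, -, h3⟩ := h
    obtain ⟨k, rfl⟩ : ∃ k', k = k' + 1 := ⟨k - 1, by
      have := (Finset.mem_Icc.1 hk).1
      omega⟩
    have hne : List.ofFn K ≠ [] := by
      intro h0
      have := congrArg List.length h0
      simp at this
    rw [List.isChain_append, List.isChain_append]
    refine ⟨⟨hI, h2, fun x hx y hy => ?_⟩, hJ, fun x hx y hy => ?_⟩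
    · have : i = x := by rw [hi, Option.mem_def.1 hx]; rfl
      rw [← this]
      refine h1 y ?_
      rw [List.head?_append, Option.mem_def.1 hy]
      rfl
    · have : j = y := by rw [hj, Option.mem_def.1 hy]; rfl
      rw [← this]
      refine h3 x ?_ j (by simp)
      rwa [List.getLast?_append_of_ne_nil _ hne] at hx
  have hsum := mul_entrySum_le_entrySum_mul (listProd_nonneg hMi I) (listProd_nonneg hMi J)
    (hcle i j)
  rw [Finset.mul_sum, Finset.sum_mul, entrySum_sum] at hsum
  simp only [Finset.mul_sum, Finset.sum_mul, entrySum_sum] at hsum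
  rw [normWeight_of_isChain hI, normWeight_of_isChain hJ]
  set E := entrySum (listProd Mi I) * entrySum (listProd Mi J)
  by_contra! hlt
  have hsmall : ∀ k ∈ Finset.Icc 1 r, ∀ K ∈ connectingWords A k i j,
      entrySum (listProd Mi I * wordProd Mi K * listProd Mi J) ≤ E * c / T := by
    intro k hk K hK
    have h := hlt (List.ofFn K) (by
      rw [List.length_ofFn]
      exact (Finset.mem_Icc.1 hk).2)
    rw [normWeight_of_isChain (hchain k hk K hK), listProd_append, listProd_append,
      listProd_ofFn] at h
    rw [le_div_iff₀ hT0]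
    rw [div_mul_eq_mul_div, div_lt_iff₀ hc] at h
    linarith
  have hE : 0 < E := by
    have h := hlt [] (Nat.zero_le _)
    exact (mul_nonneg (by positivity) (normWeight_nonneg hMi _)).trans_lt h
  -- An actual connector is needed to make the total strictly too small.
  have hex : ∃ k ∈ Finset.Icc 1 r, ∃ K : Fin k → Fin m, K ∈ connectingWords A k i j := by
    by_contra! hno
    have hz : ∀ k ∈ Finset.Icc 1 r, ∑ K ∈ connectingWords A k i j, wordProd Mi K = 0 :=
      fun k hk => Finset.sum_eq_zero fun K hK => absurd hK (hno k hk K)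
    have h := H i j ⟨0, hd⟩ ⟨0, hd⟩
    rw [Finset.sum_eq_zero hz] at h
    exact lt_irrefl _ h
  obtain ⟨k₀, hk₀, K₀, hK₀⟩ := hex
  have hstrict : entrySum (listProd Mi I * wordProd Mi K₀ * listProd Mi J) < E * c / T := by
    have h := hlt (List.ofFn K₀) (by
      rw [List.length_ofFn]
      exact (Finset.mem_Icc.1 hk₀).2)
    rw [normWeight_of_isChain (hchain k₀ hk₀ K₀ hK₀), listProd_append, listProd_append,
      listProd_ofFn] at h
    rw [lt_div_iff₀ hT0]
    rw [div_mul_eq_mul_div, div_lt_iff₀ hc] at h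
    linarith
  have hinner : ∀ k ∈ Finset.Icc 1 r, (∑ K ∈ connectingWords A k i j,
      entrySum (listProd Mi I * wordProd Mi K * listProd Mi J)) ≤ (m : ℝ) ^ k * (E * c / T) := by
    intro k hk
    refine (Finset.sum_le_card_nsmul _ _ _ (hsmall k hk)).trans ?_
    rw [nsmul_eq_mul]
    have hcard : ((connectingWords A k i j).card : ℝ) ≤ (m : ℝ) ^ k := by
      have h := Finset.card_le_univ (connectingWords A k i j)
      rw [Fintype.card_fun, Fintype.card_fin, Fintype.card_fin] at h
      exact_mod_cast h
    exact mul_le_mul_of_nonneg_right hcard (by positivity)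
  have hinner₀ : (∑ K ∈ connectingWords A k₀ i j,
      entrySum (listProd Mi I * wordProd Mi K * listProd Mi J)) < (m : ℝ) ^ k₀ * (E * c / T) := by
    refine (Finset.sum_lt_sum (hsmall k₀ hk₀) ⟨K₀, hK₀, hstrict⟩).trans_le ?_
    rw [Finset.sum_const, nsmul_eq_mul]
    have hcard : ((connectingWords A k₀ i j).card : ℝ) ≤ (m : ℝ) ^ k₀ := by
      have h := Finset.card_le_univ (connectingWords A k₀ i j)
      rw [Fintype.card_fun, Fintype.card_fin, Fintype.card_fin] at h
      exact_mod_cast h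
    exact mul_le_mul_of_nonneg_right hcard (by positivity)
  have htot := Finset.sum_lt_sum hinner ⟨k₀, hk₀, hinner₀⟩
  rw [← Finset.sum_mul, ← hT, mul_div_cancel₀ _ hT0.ne'] at htot
  linarith

theorem exists_letter_pos (hm : 0 < m) (hd : 0 < d) (hMi : ∀ i s t, 0 ≤ Mi i s t)
    (H2 : IsIrreducibleFamily A Mi) : ∃ a, 0 < normWeight A Mi [a] := by
  obtain ⟨r, hr, H⟩ := H2
  by_contra! hle
  have hzero : ∀ a, Mi a = 0 := by
    intro a
    have h1 := hle a
    rw [normWeight_of_isChain (List.IsChain.singleton a), listProd_cons] at h1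
    have h2 : listProd Mi [] = 1 := rfl
    rw [h2, mul_one] at h1
    ext s t
    exact le_antisymm ((le_entrySum (hMi a) s t).trans h1) (hMi a s t)
  have hz : ∀ k ∈ Finset.Icc 1 r, ∑ K ∈ connectingWords A k ⟨0, hm⟩ ⟨0, hm⟩, wordProd Mi K = 0 := by
    intro k hk
    obtain ⟨k, rfl⟩ : ∃ k', k = k' + 1 := ⟨k - 1, by
      have := (Finset.mem_Icc.1 hk).1
      omega⟩
    refine Finset.sum_eq_zero fun K _ => ?_
    rw [← listProd_ofFn, List.ofFn_succ, listProd_cons, hzero, zero_mul]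
  have h := H ⟨0, hm⟩ ⟨0, hm⟩ ⟨0, hd⟩ ⟨0, hd⟩
  rw [Finset.sum_eq_zero hz] at h
  exact lt_irrefl _ h

theorem exists_log_normWeight_bound (hMi : ∀ i s t, 0 ≤ Mi i s t) : ∃ D : ℝ, 0 ≤ D ∧
    ∀ l, 0 < normWeight A Mi l → |Real.log (normWeight A Mi l)| ≤ D * (l.length + 1) := by
  obtain ⟨c, hc, hlo⟩ := exists_pow_le_listProd hMi
  set B : ℝ := 1 + ∑ a, normWeight A Mi [a] with hB
  have hB1 : 1 ≤ B := le_add_of_nonneg_right (Finset.sum_nonneg fun a _ => normWeight_nonneg hMi _)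
  have hBa : ∀ a, normWeight A Mi [a] ≤ B := by
    intro a
    have := Finset.single_le_sum (f := fun a => normWeight A Mi [a])
      (fun a _ => normWeight_nonneg hMi _) (Finset.mem_univ a)
    linarith
  set E : ℝ := 1 + normWeight A Mi [] with hE
  have hE1 : 1 ≤ E := le_add_of_nonneg_right (normWeight_nonneg hMi _)
  have hup : ∀ l, normWeight A Mi l ≤ E * B ^ l.length := by
    intro l
    induction l with
    | nil => simp [hE]
    | cons a l ih =>
      have h := normWeight_append_le (A := A) hMi [a] l
      rw [List.singleton_append] at h
      calc _ ≤ _ := h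
        _ ≤ B * (E * B ^ l.length) := by
            gcongr
            · exact normWeight_nonneg hMi _
            · exact hBa a
        _ = _ := by rw [List.length_cons, pow_succ]; ring
  refine ⟨|Real.log c| + Real.log E + Real.log B,
    add_nonneg (add_nonneg (abs_nonneg _) (Real.log_nonneg hE1)) (Real.log_nonneg hB1),
    fun l hl => ?_⟩
  have hlE := Real.log_nonneg hE1
  have hlB := Real.log_nonneg hB1
  have hn : (0 : ℝ) ≤ l.length := Nat.cast_nonneg _
  have h1 : Real.log (normWeight A Mi l) ≤ Real.log E + l.length * Real.log B := by
    rw [← Real.log_pow, ← Real.log_mul (by positivity) (by positivity)]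
    exact Real.log_le_log hl (hup l)
  have h2 : l.length * Real.log c ≤ Real.log (normWeight A Mi l) := by
    have hch : l.IsChain fun i j => A i j = 1 := by
      by_contra h
      rw [normWeight_of_not_isChain h] at hl
      exact lt_irrefl _ hl
    rw [normWeight_of_isChain hch] at hl ⊢
    obtain ⟨s, t, hst⟩ := exists_entry_pos hl
    rw [← Real.log_pow]
    exact Real.log_le_log (by positivity)
      ((hlo l s t hst).trans (le_entrySum (listProd_nonneg hMi l) s t))
  have h3 : -(l.length * |Real.log c|) ≤ l.length * Real.log c := by
    have := mul_le_mul_of_nonneg_left (neg_abs_le (Real.log c)) hn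
    linarith
  rw [abs_le]
  have h4 := abs_nonneg (Real.log c)
  constructor <;> nlinarith [mul_nonneg hn hlE, mul_nonneg hn hlB, mul_nonneg hn h4]

theorem weight_normWeight (hm : 0 < m) (hd : 0 < d) (hMi : ∀ i s t, 0 ≤ Mi i s t)
    (H2 : IsIrreducibleFamily A Mi) : Weight (normWeight A Mi) where
  nonneg := normWeight_nonneg hMi
  append_le := normWeight_append_le hMi
  exists_letter := exists_letter_pos hm hd hMi H2
  connect := exists_connect hm hd hMi H2
  log_bound := exists_log_normWeight_bound hMi

end MatrixWeight

/-! ### Passage between the subshift and weights on the full shift -/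

section Subshift

variable {m d : ℕ} {A : Matrix (Fin m) (Fin m) ℤ}

/-- A zero row of `A` would be a zero row of every positive power. -/
theorem exists_successor (hA : ∀ i j, A i j = 0 ∨ A i j = 1) (hAprim : A.IsPrimitive)
    (i : Fin m) : ∃ j, A i j = 1 := by
  by_contra! h
  obtain ⟨k, hk, hpos⟩ := hAprim.exists_pos_pow
  obtain ⟨k, rfl⟩ : ∃ k', k = k' + 1 := ⟨k - 1, by omega⟩
  have h1 := hpos i i
  rw [pow_succ', Matrix.mul_apply, Finset.sum_eq_zero fun j _ => by
    rw [(hA i j).resolve_right (h j), zero_mul]] at h1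
  exact lt_irrefl _ h1

/-- Extend `J` by successors. Without a point in the cylinder, the supremum in `pressureSeq` would
be the default value `0`. -/
theorem cylinder_nonempty (hm : 0 < m) (hsucc : ∀ i, ∃ j, A i j = 1) {n : ℕ} {J : Fin n → Fin m}
    (hJ : Admissible A J) : (cylinder A J).Nonempty := by
  choose f hf using hsucc
  let x : ℕ → Fin m := fun k => Nat.rec (if h : 0 < n then J ⟨0, h⟩ else ⟨0, hm⟩)
    (fun k y => if h : k + 1 < n then J ⟨k + 1, h⟩ else f y) k
  have hx : ∀ k (hk : k < n), x k = J ⟨k, hk⟩ := by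
    intro k hk
    cases k with
    | zero => exact dif_pos hk
    | succ k => exact dif_pos hk
  refine ⟨⟨x, fun k => ?_⟩, fun k => hx k k.2⟩
  by_cases hk : k + 1 < n
  · rw [hx k (by omega), hx (k + 1) hk]
    exact hJ k hk
  · have : x (k + 1) = f (x k) := dif_neg hk
    rw [this]
    exact hf _

theorem shift_iterate_apply (x : Subshift A) (k i : ℕ) :
    ((shift A)^[k] x).1 i = x.1 (k + i) := by
  induction k generalizing x with
  | zero => simp
  | succ k ih =>
    rw [Function.iterate_succ_apply, ih]
    change x.1 (k + i + 1) = _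
    rw [Nat.succ_add]

theorem orbitProd_eq {M : Subshift A → Matrix (Fin d) (Fin d) ℝ}
    {Mi : Fin m → Matrix (Fin d) (Fin d) ℝ} (H1 : IsLocallyConst M Mi) {n : ℕ}
    {J : Fin n → Fin m} {x : Subshift A} (hx : x ∈ cylinder A J) :
    orbitProd M n x = wordProd Mi J := by
  unfold orbitProd wordProd
  congr 2
  funext k
  rw [H1, shift_iterate_apply, add_zero, hx k]

theorem nonneg_of_isLocallyConst (hm : 0 < m) (hsucc : ∀ i, ∃ j, A i j = 1)
    {M : Subshift A → Matrix (Fin d) (Fin d) ℝ} (hM : ∀ x s t, 0 ≤ M x s t)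
    {Mi : Fin m → Matrix (Fin d) (Fin d) ℝ} (H1 : IsLocallyConst M Mi) (i : Fin m)
    (s t : Fin d) : 0 ≤ Mi i s t := by
  obtain ⟨x, hx⟩ := cylinder_nonempty hm hsucc (J := fun _ : Fin 1 => i)
    (fun k hk => absurd hk (by omega))
  have h0 : x.1 0 = i := hx 0
  rw [← h0, ← H1 x]
  exact hM x s t

theorem pressureSeq_eq (hm : 0 < m) (hsucc : ∀ i, ∃ j, A i j = 1)
    {M : Subshift A → Matrix (Fin d) (Fin d) ℝ} {Mi : Fin m → Matrix (Fin d) (Fin d) ℝ}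
    (H1 : IsLocallyConst M Mi) {q : ℝ} (hq : 0 < q) (n : ℕ) :
    pressureSeq M q n = Real.log (wordSum n fun l => normWeight A Mi l ^ q) / n := by
  classical
  have hsum : (∑ J ∈ words A n, ⨆ x : cylinder A J, entrySum (orbitProd M n x.1) ^ q) =
      wordSum n fun l => normWeight A Mi l ^ q := by
    unfold words wordSum
    rw [Finset.sum_filter]
    refine Finset.sum_congr rfl fun J _ => ?_
    dsimp only
    by_cases hJ : Admissible A J
    · rw [if_pos hJ, normWeight_of_isChain (isChain_ofFn_iff.2 hJ), listProd_ofFn]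
      have : Nonempty (cylinder A J) := (cylinder_nonempty hm hsucc hJ).to_subtype
      simp only [fun x : cylinder A J => orbitProd_eq H1 x.2, ciSup_const]
    · rw [if_neg hJ, normWeight_of_not_isChain (fun h => hJ (isChain_ofFn_iff.1 h)),
        Real.zero_rpow hq.ne']
  rw [pressureSeq, hsum, one_div_mul_eq_div]

/-- Positive weight on every prefix already forces admissibility, so the dimension may be computed
in the full shift. -/
theorem coe_image_levelSet (Mi : Fin m → Matrix (Fin d) (Fin d) ℝ) (α : ℝ) :
    Subtype.val '' levelSet A Mi α = toFullShift '' growthSet (normWeight A Mi) α := by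
  have hchain : ∀ (x : ℕ → Fin m), (∀ k, A (x k) (x (k + 1)) = 1) → ∀ n,
      normWeight A Mi (pre x n) = entrySum (wordProd Mi fun k : Fin n => x k) := by
    intro x hx n
    rw [← listProd_ofFn]
    exact normWeight_of_isChain (isChain_ofFn_iff.2 fun k _ => hx k)
  ext x
  constructor
  · rintro ⟨y, ⟨hy1, hy2⟩, rfl⟩
    refine ⟨y.1, ⟨fun n => ?_, ?_⟩, rfl⟩
    · rw [hchain y.1 y.2]
      exact hy1 n
    · simp only [hchain y.1 y.2]
      exact hy2
  · rintro ⟨y, ⟨hy1, hy2⟩, rfl⟩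
    have hadm : ∀ k, A (y k) (y (k + 1)) = 1 := by
      intro k
      have h : (pre y (k + 2)).IsChain fun i j => A i j = 1 := by
        by_contra h
        have := hy1 (k + 2)
        rw [normWeight_of_not_isChain h] at this
        exact lt_irrefl _ this
      exact isChain_ofFn_iff.1 h k (by omega)
    simp only [hchain y hadm] at hy1 hy2
    exact ⟨⟨y, hadm⟩, ⟨hy1, hy2⟩, rfl⟩

end Subshift

end MatrixPressure

end

theorem theorem3p4 (m d : ℕ) (hm : 2 ≤ m) (hd : 0 < d)
    (A : Matrix (Fin m) (Fin m) ℤ) (hA : ∀ i j, A i j = 0 ∨ A i j = 1) (hAprim : A.IsPrimitive)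
    (M : MatrixPressure.Subshift A → Matrix (Fin d) (Fin d) ℝ)
    (hMnonneg : ∀ x s t, 0 ≤ M x s t)
    (Mi : Fin m → Matrix (Fin d) (Fin d) ℝ)
    (H1 : MatrixPressure.IsLocallyConst M Mi)
    (H2 : MatrixPressure.IsIrreducibleFamily A Mi)
    (q : ℝ) (hq : 0 < q) :
    Tendsto (MatrixPressure.pressureSeq M q) atTop (𝓝 (MatrixPressure.pressure M q)) ∧
    DifferentiableAt ℝ (MatrixPressure.pressure M) q ∧
    ∀ α : ℝ, HasDerivAt (MatrixPressure.pressure M) α q →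
      ((dimH (MatrixPressure.levelSet A Mi α) : ENNReal) : EReal) =
        ((1 / Real.log (m : ℝ) * (-α * q + MatrixPressure.pressure M q) : ℝ) : EReal) := by
  have hm0 : 0 < m := by omega
  have hsucc := MatrixPressure.exists_successor hA hAprim
  have hMi := MatrixPressure.nonneg_of_isLocallyConst hm0 hsucc hMnonneg H1
  have hw := MatrixPressure.weight_normWeight hm0 hd hMi H2
  have hlim : ∀ p : ℝ, 0 < p → Tendsto (MatrixPressure.pressureSeq M p) atTop
      (𝓝 (MatrixPressure.Weight.press fun l => MatrixPressure.normWeight A Mi l ^ p)) := by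
    intro p hp
    rw [funext fun n => MatrixPressure.pressureSeq_eq hm0 hsucc H1 hp n]
    exact (hw.rpow hp).tendsto_press
  have hpress : ∀ p : ℝ, 0 < p → MatrixPressure.pressure M p =
      MatrixPressure.Weight.press fun l => MatrixPressure.normWeight A Mi l ^ p :=
    fun p hp => (hlim p hp).limUnder_eq
  -- The two pressures are identified for `p > 0`; a neighbourhood of `q` suffices to transfer
  -- derivatives.
  have heq : MatrixPressure.pressure M =ᶠ[𝓝 q] fun p =>
      MatrixPressure.Weight.press fun l => MatrixPressure.normWeight A Mi l ^ p := by
    filter_upwards [lt_mem_nhds hq] with p hp using hpress p hp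
  refine ⟨?_, (hw.differentiableAt_press hq).congr_of_eventuallyEq heq, fun α hα => ?_⟩
  · rw [hpress q hq]
    exact hlim q hq
  · obtain ⟨hnn, hdim⟩ :=
      MatrixPressure.dimH_growthSet hm hw hq (hα.congr_of_eventuallyEq heq.symm)
    rw [← isometry_subtype_coe.dimH_image, MatrixPressure.coe_image_levelSet, hdim,
      EReal.coe_ennreal_ofReal, max_eq_left hnn, hpress q hq]
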